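/- For $n\ge 1$, let $A$ be a random subset of $\mathbb{F}_2^n$ containing each element with probability $\frac12$, independently of the other elements, and let $\omega_n$ be the clique number of the random Cayley graph with vertex set $\mathbb{F}_2^n$ in which distinct vertices $x,y$ are joined if and only if $x+y\in A$. Let $\log$ denote the logarithm to base $2$, and $\lfloor x\rfloor$ and $\{x\}$ the integer and fractional parts of a real number $x$. Let $\epsilon>0$ and let $(n_l)_{l\ge 1}$ be a sequence of integers $n_l\ge 2$ with $n_l\to\infty$ such that $\{\log n_l+\log\log n_l\}<1-\epsilon$ for every $l$. Then $$\lim_{l\to\infty}\mathbb{P}\left(\omega_{n_l}=2^{\lfloor\log n_l+\log\log n_l\rfloor}\right)=1.$$ -/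

import Mathlib

open Filter Topology MeasureTheory ProbabilityTheory

/-- The group `𝔽₂ⁿ`. -/
abbrev F2 (n : ℕ) : Type := Fin n → ZMod 2

/-- The Cayley sum graph on an abelian group `G` generated by `A ⊆ G`: distinct vertices `x`, `y`
are joined if and only if `x + y ∈ A`. -/
def cayleySumGraph {G : Type*} [AddCommGroup G] (A : Set G) : SimpleGraph G where
  Adj x y := x ≠ y ∧ x + y ∈ A
  symm := ⟨fun x y h => ⟨h.1.symm, by rw [add_comm]; exact h.2⟩⟩
  loopless := ⟨fun _ h => h.1 rfl⟩

/-- The law of a uniformly random subset of `G`: each element of `G` belongs to it with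
probability `1/2`, independently of the other elements. -/
noncomputable def randomSubset (G : Type*) : Measure (Set G) :=
  setBernoulli (Set.univ : Set G) (⟨1 / 2, by norm_num, by norm_num⟩ : unitInterval)

/-- The clique number `ω_n` of the Cayley graph on `𝔽₂ⁿ` generated by `A`; it is a random variable
when `A` is distributed according to `randomSubset (F2 n)`. -/
noncomputable def cayleyCliqueNum (n : ℕ) (A : Set (F2 n)) : ℕ :=
  (cayleySumGraph A).cliqueNum

/-! Let k be the integer part of log n + log log n. A subspace whose nonzero elements lie in A is a
clique, and a clique with more than 2^k vertices can be translated and trimmed to a set X of 2^k + 1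
elements that contains 0 and has all its nonzero sums in A. The size of k gives 2^k + n ≤ nk, and
the fractional part being below 1 - ε gives (1 + 2^(-i)) nk ≤ 2^(k+1) for a fixed i. These two
inequalities drive the two halves.

Lower bound: second moment method for graphs of linear maps from 𝔽₂^k to 𝔽₂^(n-k). Two graphs meet
in the kernel of the difference of the maps. Large kernels are rare enough to make the variance
negligible (`sum_two_pow_kerCount_le`, `le_card_exists_graphFinset_subset`).

Upper bound: the sets X are too many for a direct union bound, so every X + X is shown to contain a
member of a family that can be described in fewer bits than its members have elements. If |X + X| ≥
2^p |X|, expansion by independent sets bounds the rank of X. A small subset Y then determines a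
container for X, so that at most 2^(s/2) sets have s sums (`card_filter_card_add_self_eq_le`).
Otherwise Plünnecke and Ruzsa bound the rank by k + O(1), and a basis costs about nk bits. If nearly
2^(k+1) sums are popular, a sparse random Y ⊆ X already has them all among its sums, and Y is cheap
once a basis is known. If not, a subset of X with nearly 2^k elements has fewer than 2^(k+1) sums.
Kneser's theorem places it inside a union of cosets of a large subgroup, of total size exactly 2^k,
and one further element of X restores almost 2^(k+1) sums (`exists_mem_family_subset_add`). -/

/-! ### Kneser's theorem for finite abelian groups. -/

section Kneser

open scoped Pointwise

variable {G : Type*} [AddCommGroup G] [Fintype G] [DecidableEq G]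

set_option linter.unusedSectionVars false

open Classical in
/-- The elements of a subgroup, as a finset. -/
noncomputable def subgroupFinset (H : AddSubgroup G) : Finset G := Finset.univ.filter (· ∈ H)

@[simp] lemma mem_subgroupFinset {H : AddSubgroup G} {x : G} : x ∈ subgroupFinset H ↔ x ∈ H := by
  simp [subgroupFinset]

lemma card_subgroupFinset_mono {H K : AddSubgroup G} (h : H ≤ K) :
    (subgroupFinset H).card ≤ (subgroupFinset K).card :=
  Finset.card_le_card fun x hx => by simpa using h (by simpa using hx)

/-- The stabilizer of a finite set under translation. -/
abbrev translateStab (C : Finset G) : AddSubgroup G := AddAction.stabilizer G C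

lemma mem_translateStab {C : Finset G} {h : G} : h ∈ translateStab C ↔ ∀ c ∈ C, h + c ∈ C := by
  simpa using AddAction.mem_stabilizer_finset' (s := C) (a := h)

lemma add_mem_iff_of_mem_translateStab {C : Finset G} {h c : G} (hh : h ∈ translateStab C) :
    h + c ∈ C ↔ c ∈ C := by
  simpa using (AddAction.mem_stabilizer_finset.1 hh c)

/-- Two pairs with the same image c + x + y differ by an element of both subgroups, so the fibres
have at most |H₁ ∩ H₂| elements. -/
lemma card_mul_card_le_of_add {H₁ H₂ : AddSubgroup G} {L R D : Finset G} (c : G)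
    (hL : ∀ x ∈ L, x ∈ H₁) (hR : ∀ x ∈ R, x ∈ H₂) (hD : ∀ x ∈ L, ∀ y ∈ R, c + x + y ∈ D) :
    L.card * R.card ≤ (subgroupFinset (H₁ ⊓ H₂)).card * D.card := by
  classical
  rw [← Finset.card_product]
  have h1 : ((L ×ˢ R).image fun p : G × G => c + p.1 + p.2).card ≤ D.card := by
    apply Finset.card_le_card
    intro z hz
    obtain ⟨p, hp, rfl⟩ := Finset.mem_image.1 hz
    rw [Finset.mem_product] at hp
    exact hD _ hp.1 _ hp.2
  refine le_trans (Finset.card_le_mul_card_image (f := fun p : G × G => c + p.1 + p.2) _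
    (subgroupFinset (H₁ ⊓ H₂)).card ?_) (Nat.mul_le_mul_left _ h1)
  intro z hz
  obtain ⟨p, hp, rfl⟩ := Finset.mem_image.1 hz
  rw [Finset.mem_product] at hp
  refine Finset.card_le_card_of_injOn (fun q => q.1 - p.1) ?_ ?_
  · intro q hq
    simp only [Finset.coe_filter, Finset.mem_product, Set.mem_ofPred_eq] at hq
    obtain ⟨⟨h1, h2⟩, h3⟩ := hq
    have h4 : q.1 - p.1 = p.2 - q.2 := by
      have h5 : q.1 + q.2 = p.1 + p.2 := by
        have := h3
        rw [add_assoc, add_assoc] at this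
        exact add_left_cancel this
      rw [sub_eq_sub_iff_add_eq_add, h5, add_comm]
    simp only [Finset.mem_coe, mem_subgroupFinset, AddSubgroup.mem_inf]
    exact ⟨H₁.sub_mem (hL _ h1) (hL _ hp.1), h4 ▸ H₂.sub_mem (hR _ hp.2) (hR _ h2)⟩
  · intro q hq q' hq' h
    simp only [Finset.coe_filter, Finset.mem_product, Set.mem_ofPred_eq] at hq hq'
    have h1 : q.1 = q'.1 := by simpa using h
    have h2 := hq.2.trans hq'.2.symm
    rw [h1] at h2
    exact Prod.ext h1 (add_left_cancel h2)

/-- Choose c in C₂ but not in C₁. For x in H₁ and y in H₂, membership of c + x + y in C₁ depends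
only on y, and membership in C₂ only on x. Hence L + R' shifted by c misses C₁ inside C₂, and L' + R
shifted by c does the reverse. If R is empty, all of c + H₂ avoids C₁, which is the second
alternative. -/
lemma card_union_stab_aux {C₁ C₂ : Finset G} (h : ¬ translateStab C₁ ≤ translateStab (C₁ ∪ C₂)) :
    (subgroupFinset (translateStab C₁)).card + (subgroupFinset (translateStab C₂)).card ≤
      ((C₁ ∪ C₂) \ C₁).card + ((C₁ ∪ C₂) \ C₂).card +
        2 * (subgroupFinset (translateStab C₁ ⊓ translateStab C₂)).card ∨
    (subgroupFinset (translateStab C₂)).card ≤ ((C₁ ∪ C₂) \ C₁).card := by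
  classical
  set H₁ := translateStab C₁ with hH₁
  set H₂ := translateStab C₂ with hH₂
  obtain ⟨g, hg₁, hg⟩ := SetLike.not_le_iff_exists.1 h
  rw [mem_translateStab] at hg
  push Not at hg
  obtain ⟨c, hc, hgc⟩ := hg
  have hc₁ : c ∉ C₁ := fun h1 => hgc (Finset.mem_union_left _ (mem_translateStab.1 hg₁ c h1))
  have hc₂ : c ∈ C₂ := by simpa [hc₁] using hc
  set R := (subgroupFinset H₂).filter fun x => x + c ∈ C₁ with hR
  set L := (subgroupFinset H₁).filter fun x => x + c ∈ C₂ with hL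
  set h₀ := (subgroupFinset (H₁ ⊓ H₂)).card with hh₀
  have hRc : (subgroupFinset H₂).card =
      R.card + ((subgroupFinset H₂).filter fun x => x + c ∉ C₁).card :=
    (Finset.card_filter_add_card_filter_not (s := subgroupFinset H₂) _).symm
  have hLc : (subgroupFinset H₁).card =
      L.card + ((subgroupFinset H₁).filter fun x => x + c ∉ C₂).card :=
    (Finset.card_filter_add_card_filter_not (s := subgroupFinset H₁) _).symm
  set R' := (subgroupFinset H₂).filter fun x => x + c ∉ C₁ with hR'
  set L' := (subgroupFinset H₁).filter fun x => x + c ∉ C₂ with hL'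
  by_cases hRe : R = ∅
  · right
    refine Finset.card_le_card_of_injOn (fun x => x + c) ?_ fun x _ y _ hxy => add_right_cancel hxy
    intro x hx
    have hx' : x ∈ H₂ := by simpa using hx
    have h1 : x + c ∈ C₂ := mem_translateStab.1 hx' c hc₂
    have h2 : x + c ∉ C₁ := fun h => by
      have : x ∈ R := by simp [hR, hx', h]
      simp [hRe] at this
    simp [h1, h2]
  left
  -- All four sets contain a translate of H₁ ∩ H₂. Sizes at least h₀ turn the product bounds into a
  -- bound on the sum: (h₀ + a)(h₀ + b) ≥ h₀ (h₀ + a + b).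
  have big : ∀ (S : Finset G) (x : G), (∀ y ∈ subgroupFinset (H₁ ⊓ H₂), y + x ∈ S) →
      h₀ ≤ S.card := fun S x hS =>
    Finset.card_le_card_of_injOn (fun y => y + x) (fun y hy => hS y hy)
      fun y _ y' _ hyy => add_right_cancel hyy
  have b1 : h₀ ≤ L.card := big L 0 fun y hy => by
    rw [mem_subgroupFinset, AddSubgroup.mem_inf] at hy
    simp [hL, hy.1, mem_translateStab.1 hy.2 c hc₂]
  have b2 : h₀ ≤ R'.card := big R' 0 fun y hy => by
    rw [mem_subgroupFinset, AddSubgroup.mem_inf] at hy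
    simp [hR', hy.2, add_mem_iff_of_mem_translateStab hy.1, hc₁]
  have b3 : h₀ ≤ L'.card := big L' g fun y hy => by
    rw [mem_subgroupFinset, AddSubgroup.mem_inf] at hy
    have : g + c ∉ C₂ := fun h => hgc (Finset.mem_union_right _ h)
    simp [hL', H₁.add_mem hy.1 hg₁, add_assoc, add_mem_iff_of_mem_translateStab hy.2, this]
  have b4 : h₀ ≤ R.card := by
    obtain ⟨r, hr⟩ := Finset.nonempty_iff_ne_empty.2 hRe
    refine big R r fun y hy => ?_
    rw [mem_subgroupFinset, AddSubgroup.mem_inf] at hy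
    simp only [hR, Finset.mem_filter, mem_subgroupFinset] at hr ⊢
    exact ⟨H₂.add_mem hy.2 hr.1, by
      rw [add_assoc, add_mem_iff_of_mem_translateStab hy.1]; exact hr.2⟩
  have c1 : L.card * R'.card ≤ h₀ * ((C₁ ∪ C₂) \ C₁).card := by
    refine card_mul_card_le_of_add c (H₁ := H₁) (H₂ := H₂) (fun x hx => ?_) (fun x hx => ?_)
      fun x hx y hy => ?_
    · simp only [hL, Finset.mem_filter, mem_subgroupFinset] at hx; exact hx.1
    · simp only [hR', Finset.mem_filter, mem_subgroupFinset] at hx; exact hx.1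
    · simp only [hL, hR', Finset.mem_filter, mem_subgroupFinset] at hx hy
      have e1 : c + x + y ∈ C₂ := by
        rw [add_comm _ y, add_comm c x]
        exact (add_mem_iff_of_mem_translateStab hy.1).2 hx.2
      have e2 : c + x + y ∉ C₁ := by
        rw [add_comm c x, add_assoc, add_comm c y, add_mem_iff_of_mem_translateStab hx.1]
        exact hy.2
      simp [e1, e2]
  have c2 : L'.card * R.card ≤ h₀ * ((C₁ ∪ C₂) \ C₂).card := by
    refine card_mul_card_le_of_add c (H₁ := H₁) (H₂ := H₂) (fun x hx => ?_) (fun x hx => ?_)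
      fun x hx y hy => ?_
    · simp only [hL', Finset.mem_filter, mem_subgroupFinset] at hx; exact hx.1
    · simp only [hR, Finset.mem_filter, mem_subgroupFinset] at hx; exact hx.1
    · simp only [hL', hR, Finset.mem_filter, mem_subgroupFinset] at hx hy
      have e1 : c + x + y ∉ C₂ := by
        rw [add_comm _ y, add_comm c x, add_mem_iff_of_mem_translateStab hy.1]
        exact hx.2
      have e2 : c + x + y ∈ C₁ := by
        rw [add_comm c x, add_assoc, add_comm c y, add_mem_iff_of_mem_translateStab hx.1]
        exact hy.2
      simp [e1, e2]
  have hpos : 0 < h₀ := Finset.card_pos.2 ⟨0, by simp⟩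
  rw [hRc, hLc]
  refine Nat.le_of_mul_le_mul_left ?_ hpos
  obtain ⟨l, hl⟩ := Nat.exists_eq_add_of_le b1
  obtain ⟨r', hr'⟩ := Nat.exists_eq_add_of_le b2
  obtain ⟨l', hl'⟩ := Nat.exists_eq_add_of_le b3
  obtain ⟨r, hr⟩ := Nat.exists_eq_add_of_le b4
  rw [hl, hr'] at c1
  rw [hl', hr] at c2
  rw [hl, hr', hl', hr]
  nlinarith [Nat.zero_le (l * r'), Nat.zero_le (l' * r)]

/-- The union step in Kneser's theorem. -/
lemma card_union_add_card_stab {C₁ C₂ : Finset G} {t : ℕ}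
    (h₁ : t ≤ C₁.card + (subgroupFinset (translateStab C₁)).card)
    (h₂ : t ≤ C₂.card + (subgroupFinset (translateStab C₂)).card) :
    t ≤ (C₁ ∪ C₂).card + (subgroupFinset (translateStab (C₁ ∪ C₂))).card := by
  have e1 : ((C₁ ∪ C₂) \ C₁).card + C₁.card = (C₁ ∪ C₂).card :=
    Finset.card_sdiff_add_card_eq_card Finset.subset_union_left
  have e2 : ((C₁ ∪ C₂) \ C₂).card + C₂.card = (C₁ ∪ C₂).card :=
    Finset.card_sdiff_add_card_eq_card Finset.subset_union_right
  have e3 : (subgroupFinset (translateStab C₁ ⊓ translateStab C₂)).card ≤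
      (subgroupFinset (translateStab (C₁ ∪ C₂))).card := by
    refine card_subgroupFinset_mono fun g hg => ?_
    rw [AddSubgroup.mem_inf, mem_translateStab, mem_translateStab] at hg
    rw [mem_translateStab]
    intro c hc
    rcases Finset.mem_union.1 hc with h | h
    · exact Finset.mem_union_left _ (hg.1 c h)
    · exact Finset.mem_union_right _ (hg.2 c h)
  by_cases hs₁ : translateStab C₁ ≤ translateStab (C₁ ∪ C₂)
  · have := card_subgroupFinset_mono hs₁
    omega
  by_cases hs₂ : translateStab C₂ ≤ translateStab (C₁ ∪ C₂)
  · have := card_subgroupFinset_mono hs₂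
    omega
  -- A first alternative on either side, or the second alternative on both, yields the claim after
  -- adding `h₁` and `h₂`.
  have k1 := card_union_stab_aux hs₁
  have k2 := card_union_stab_aux (C₁ := C₂) (C₂ := C₁) (by rwa [Finset.union_comm])
  rw [Finset.union_comm C₂ C₁, inf_comm] at k2
  omega

/-- A consequence of the Dyson transform: every element of `A + B` lies in a large subset of `A + B`
that is periodic. -/
lemma exists_subset_add_card_stab (A B : Finset G) (hA : (0 : G) ∈ A) (hB : (0 : G) ∈ B) :
    ∃ C ⊆ A + B, (0 : G) ∈ C ∧
      A.card + B.card ≤ C.card + (subgroupFinset (translateStab C)).card := by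
  induction hn : B.card using Nat.strong_induction_on generalizing A B with
  | _ n ih =>
  by_cases h : ∀ e ∈ A, ∀ b ∈ B, e + b ∈ A
  -- Here A + B ⊆ A, so B lies in the stabilizer of A.
  · refine ⟨A, fun a ha => Finset.mem_add.2 ⟨a, ha, 0, hB, add_zero a⟩, hA, ?_⟩
    rw [← hn]
    refine Nat.add_le_add_left (Finset.card_le_card fun b hb => ?_) _
    rw [mem_subgroupFinset, mem_translateStab]
    intro c hc
    rw [add_comm]
    exact h c hc b hb
  · push Not at h
    obtain ⟨e, he, b, hb, heb⟩ := h
    -- The Dyson e-transform: it keeps |A| + |B| and does not enlarge the sumset, while B loses b.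
    set A' := A ∪ B.image (e + ·) with hA'
    set B' := B.filter (fun x => e + x ∈ A) with hB'
    have hlt : B'.card < n := by
      rw [← hn]
      refine Finset.card_lt_card (Finset.filter_ssubset.2 ⟨b, hb, heb⟩)
    obtain ⟨C, hC, h0, hc⟩ := ih _ hlt A' B' (Finset.mem_union_left _ hA)
      (by simp [hB', hB, he]) rfl
    refine ⟨C, fun c hcC => ?_, h0, ?_⟩
    · obtain ⟨x, hx, y, hy, rfl⟩ := Finset.mem_add.1 (hC hcC)
      rw [hB', Finset.mem_filter] at hy
      rcases Finset.mem_union.1 hx with hx | hx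
      · exact Finset.add_mem_add hx hy.1
      · obtain ⟨z, hz, rfl⟩ := Finset.mem_image.1 hx
        have : e + z + y = (e + y) + z := by abel
        rw [this]
        exact Finset.add_mem_add hy.2 hz
    · refine le_trans (le_of_eq ?_) hc
      have h1 := Finset.card_union_add_card_inter A (B.image (e + ·))
      rw [Finset.card_image_of_injective _ (add_right_injective e), ← hA'] at h1
      have h2 : B'.card = (A ∩ B.image (e + ·)).card := by
        rw [← Finset.card_image_of_injective B' (add_right_injective e)]
        congr 1
        ext x
        simp only [hB', Finset.mem_image, Finset.mem_filter, Finset.mem_inter]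
        constructor
        · rintro ⟨y, ⟨hy, hy'⟩, rfl⟩
          exact ⟨hy', y, hy, rfl⟩
        · rintro ⟨hx, y, hy, rfl⟩
          exact ⟨y, ⟨hy, hx⟩, rfl⟩
      omega

lemma card_vadd_stab (g : G) (C : Finset G) :
    translateStab (g +ᵥ C) = translateStab C := by
  ext h
  simp only [mem_translateStab, Finset.mem_vadd_finset, vadd_eq_add]
  constructor
  · intro H c hc
    obtain ⟨y, hy, e⟩ := H (g + c) ⟨c, hc, rfl⟩
    have : y = h + c := by
      have e' : g + y = g + (h + c) := by rw [e]; abel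
      exact add_left_cancel e'
    exact this ▸ hy
  · rintro H _ ⟨c, hc, rfl⟩
    exact ⟨h + c, H c hc, by abel⟩

/-- **Kneser's theorem**, weak form. -/
theorem kneser_weak (A B : Finset G) (hA : A.Nonempty) (hB : B.Nonempty) :
    A.card + B.card ≤ (A + B).card + (subgroupFinset (translateStab (A + B))).card := by
  have key : ∀ c ∈ A + B, ∃ C ⊆ A + B, c ∈ C ∧
      A.card + B.card ≤ C.card + (subgroupFinset (translateStab C)).card := by
    intro c hc
    obtain ⟨a, ha, b, hb, rfl⟩ := Finset.mem_add.1 hc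
    obtain ⟨C, hC, h0, h⟩ := exists_subset_add_card_stab (-a +ᵥ A) (-b +ᵥ B)
      (Finset.mem_vadd_finset.2 ⟨a, ha, by simp⟩) (Finset.mem_vadd_finset.2 ⟨b, hb, by simp⟩)
    refine ⟨(a + b) +ᵥ C, ?_, Finset.mem_vadd_finset.2 ⟨0, h0, by simp⟩, ?_⟩
    · intro x hx
      obtain ⟨y, hy, rfl⟩ := Finset.mem_vadd_finset.1 hx
      obtain ⟨u, hu, v, hv, rfl⟩ := Finset.mem_add.1 (hC hy)
      obtain ⟨u, hu', rfl⟩ := Finset.mem_vadd_finset.1 hu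
      obtain ⟨v, hv', rfl⟩ := Finset.mem_vadd_finset.1 hv
      refine Finset.mem_add.2 ⟨u, hu', v, hv', ?_⟩
      simp only [vadd_eq_add]
      abel
    · rw [card_vadd_stab, Finset.card_vadd_finset]
      simpa using h
  choose! F hF hcF hcard using key
  -- The pieces through the individual points are glued one at a time by the union step, until they
  -- exhaust A + B.
  have : ∀ S : Finset G, S.Nonempty → S ⊆ A + B → A.card + B.card ≤
      (S.biUnion F).card + (subgroupFinset (translateStab (S.biUnion F))).card := by
    intro S hS
    induction hS using Finset.Nonempty.cons_induction with
    | singleton a =>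
      intro h
      rw [Finset.singleton_biUnion]
      exact hcard a (h (Finset.mem_singleton_self a))
    | cons a S ha hS ih =>
      intro h
      rw [Finset.cons_eq_insert, Finset.biUnion_insert]
      refine card_union_add_card_stab (hcard a (h (Finset.mem_cons_self a S)))
        (ih fun x hx => h (Finset.mem_cons_of_mem hx))
  have h := this (A + B) (hA.add hB) subset_rfl
  have e : (A + B).biUnion F = A + B := by
    ext x
    rw [Finset.mem_biUnion]
    exact ⟨fun ⟨c, hc, hx⟩ => hF c hc hx, fun hx => ⟨x, hx, hcF x hx⟩⟩
  rwa [e] at h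

/-- **Kneser's theorem**. -/
theorem kneser (A B : Finset G) (hA : A.Nonempty) (hB : B.Nonempty) :
    (A + subgroupFinset (translateStab (A + B))).card +
      (B + subgroupFinset (translateStab (A + B))).card ≤
    (A + B).card + (subgroupFinset (translateStab (A + B))).card := by
  set H := subgroupFinset (translateStab (A + B)) with hH
  have h0 : (0 : G) ∈ H := by simp [hH]
  -- Saturating both summands by the stabilizer leaves the sumset unchanged, so the weak form
  -- applies to the saturations.
  have e : (A + H) + (B + H) = A + B := by
    apply Finset.Subset.antisymm
    · intro x hx
      obtain ⟨u, hu, v, hv, rfl⟩ := Finset.mem_add.1 hx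
      obtain ⟨a, ha, h, hh, rfl⟩ := Finset.mem_add.1 hu
      obtain ⟨b, hb, h', hh', rfl⟩ := Finset.mem_add.1 hv
      rw [hH, mem_subgroupFinset] at hh hh'
      have e : a + h + (b + h') = h + (h' + (a + b)) := by abel
      rw [e]
      exact mem_translateStab.1 hh _ (mem_translateStab.1 hh' _ (Finset.add_mem_add ha hb))
    · intro x hx
      obtain ⟨a, ha, b, hb, rfl⟩ := Finset.mem_add.1 hx
      refine Finset.add_mem_add ?_ ?_
      · exact Finset.mem_add.2 ⟨a, ha, 0, h0, add_zero a⟩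
      · exact Finset.mem_add.2 ⟨b, hb, 0, h0, add_zero b⟩
  have := kneser_weak (A + H) (B + H) (hA.add ⟨0, h0⟩) (hB.add ⟨0, h0⟩)
  rwa [e] at this

end Kneser

/-! ### Sumsets of sets with about 2^k elements. -/

section Periodic

open scoped Pointwise

variable {G : Type*} [AddCommGroup G] [Fintype G] [DecidableEq G]

set_option linter.unusedSectionVars false

lemma card_subgroupFinset_dvd {H : AddSubgroup G} {C : Finset G} (h : H ≤ translateStab C) :
    (subgroupFinset H).card ∣ C.card := by
  classical
  rw [Finset.card_eq_sum_card_image (fun x : G => (x : G ⧸ H)) C]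
  refine Finset.dvd_sum fun q hq => ?_
  obtain ⟨c, hc, rfl⟩ := Finset.mem_image.1 hq
  refine dvd_of_eq (Finset.card_bij (fun x _ => x + c) ?_ ?_ ?_)
  · intro x hx
    rw [mem_subgroupFinset] at hx
    rw [Finset.mem_filter]
    refine ⟨mem_translateStab.1 (h hx) c hc, ?_⟩
    rw [QuotientAddGroup.eq]
    have : -(x + c) + c = -x := by abel
    rw [this]
    exact H.neg_mem hx
  · intro x _ y _ hxy
    exact add_right_cancel hxy
  · intro y hy
    rw [Finset.mem_filter, QuotientAddGroup.eq] at hy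
    refine ⟨y - c, ?_, by abel⟩
    rw [mem_subgroupFinset]
    have := H.neg_mem hy.2
    have e : -(-y + c) = y - c := by abel
    rwa [e] at this

lemma le_translateStab_add_subgroupFinset (H : AddSubgroup G) (A : Finset G) :
    H ≤ translateStab (A + subgroupFinset H) := by
  intro h hh
  rw [mem_translateStab]
  intro c hc
  obtain ⟨a, ha, x, hx, rfl⟩ := Finset.mem_add.1 hc
  rw [mem_subgroupFinset] at hx
  refine Finset.mem_add.2 ⟨a, ha, h + x, by simpa using H.add_mem hh hx, by abel⟩

lemma subset_add_subgroupFinset (H : AddSubgroup G) (A : Finset G) :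
    A ⊆ A + subgroupFinset H := fun a ha =>
  Finset.mem_add.2 ⟨a, ha, 0, by simp, add_zero a⟩

lemma card_subgroupFinset_le_of_le_translateStab {H : AddSubgroup G} {C : Finset G}
    (hC : C.Nonempty) (h : H ≤ translateStab C) : (subgroupFinset H).card ≤ C.card :=
  Nat.le_of_dvd (Finset.card_pos.2 hC) (card_subgroupFinset_dvd h)

variable [Module (ZMod 2) G]

lemma exists_card_subgroupFinset_eq_two_pow (H : AddSubgroup G) :
    ∃ h : ℕ, (subgroupFinset H).card = 2 ^ h := by
  have h1 : (subgroupFinset H).card ∣ (Finset.univ : Finset G).card :=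
    card_subgroupFinset_dvd (by
      intro x _
      rw [mem_translateStab]
      simp)
  rw [Finset.card_univ, Module.card_eq_pow_finrank (K := ZMod 2) (V := G), ZMod.card] at h1
  obtain ⟨i, _, hi⟩ := (Nat.dvd_prime_pow Nat.prime_two).1 h1
  exact ⟨i, hi⟩

/-- A set with more than `2 ^ k` elements has a sumset with at least `2 ^ (k + 1)` elements. -/
lemma two_pow_succ_le_card_add_self {k : ℕ} {W : Finset G} (hW : 2 ^ k < W.card) :
    2 ^ (k + 1) ≤ (W + W).card := by
  have hne : W.Nonempty := Finset.card_pos.1 ((Nat.zero_le _).trans_lt hW)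
  have hk := kneser W W hne hne
  set H := translateStab (W + W) with hH
  obtain ⟨h, hh⟩ := exists_card_subgroupFinset_eq_two_pow H
  have h1 := card_subgroupFinset_le_of_le_translateStab (hne.add hne) (le_refl H)
  -- Either H alone has 2^(k+1) elements, or |H| divides 2^k. In the latter case |W + H| ≥ 2^k +
  -- |H|, being a multiple of |H| above 2^k, and Kneser gives 2|W + H| - |H| ≥ 2^(k+1).
  rcases Nat.lt_or_ge k h with hkh | hkh
  · have : 2 ^ (k + 1) ≤ 2 ^ h := Nat.pow_le_pow_right (by norm_num) hkh
    omega
  · obtain ⟨a, ha⟩ := card_subgroupFinset_dvd (le_translateStab_add_subgroupFinset H W)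
    have h2 := Finset.card_le_card (subset_add_subgroupFinset H W)
    obtain ⟨b, hb⟩ := Nat.pow_dvd_pow 2 hkh
    rw [hh] at ha hk
    have h3 : 2 ^ h * b < 2 ^ h * a := by rw [← hb, ← ha]; omega
    have h4 : b + 1 ≤ a := Nat.lt_of_mul_lt_mul_left h3
    have h5 := Nat.mul_le_mul_left (2 ^ h) h4
    rw [mul_add, mul_one, ← hb, ← ha] at h5
    rw [pow_succ]
    omega

/-- A set of nearly `2 ^ k` elements whose sumset is not too large is almost all of a union of
cosets of a large subgroup, and any further element forces a sumset of almost `2 ^ (k + 1)`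
elements. -/
lemma exists_subgroup_of_card_add_self_add_le {k d e : ℕ} {X : Finset G}
    (hX : X.Nonempty) (hd : (X + X).card + d ≤ 2 ^ (k + 1)) (he : 2 ^ k ≤ X.card + e)
    (hde : 3 * e < d) :
    ∃ H : AddSubgroup G, H ≤ translateStab (X + X) ∧ d ≤ (subgroupFinset H).card + 2 * e ∧
      (X + subgroupFinset H).card = 2 ^ k ∧
      ∀ x ∉ X + subgroupFinset H, 2 ^ (k + 1) ≤ ((X + X) ∪ X.image (x + ·)).card + e := by
  have hk := kneser X X hX hX
  set H := translateStab (X + X) with hH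
  obtain ⟨h, hh⟩ := exists_card_subgroupFinset_eq_two_pow H
  have h1 := card_subgroupFinset_le_of_le_translateStab (hX.add hX) (le_refl H)
  have hXZ := Finset.card_le_card (subset_add_subgroupFinset H X)
  set Z := X + subgroupFinset H with hZ
  have hp : 2 ^ (k + 1) = 2 * 2 ^ k := by ring
  have hkh : h ≤ k := by
    by_contra hcon
    have : 2 ^ (k + 1) ≤ 2 ^ h := Nat.pow_le_pow_right (by norm_num) (by omega)
    omega
  have hHd : d ≤ (subgroupFinset H).card + 2 * e := by omega
  obtain ⟨a, ha⟩ := card_subgroupFinset_dvd (le_translateStab_add_subgroupFinset H X)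
  obtain ⟨b, hb⟩ := Nat.pow_dvd_pow 2 hkh
  rw [hh, ← hZ] at ha
  -- Both numbers are multiples of |H|. A deficit would be at least |H| ≥ d - 2e > e, too much for Z
  -- ⊇ X; an excess of |H| contradicts Kneser.
  have hZc : Z.card = 2 ^ k := by
    rw [ha, hb]
    congr 1
    apply le_antisymm
    · by_contra hcon
      have h5 := Nat.mul_le_mul_left (2 ^ h) (show b + 1 ≤ a by omega)
      rw [mul_add, mul_one, ← hb, ← ha] at h5
      omega
    · by_contra hcon
      have h5 := Nat.mul_le_mul_left (2 ^ h) (show a + 1 ≤ b by omega)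
      rw [mul_add, mul_one, ← hb, ← ha] at h5
      omega
  refine ⟨H, le_rfl, hHd, hZc, fun x hx => ?_⟩
  -- W has more than 2^k elements, hence at least 2^(k+1) sums. Since Z + Z ⊆ X + X, only sums in x
  -- + (Z \ X) can be missing from the displayed union, and |Z \ X| ≤ e.
  set W := Z ∪ {x} with hW
  have hWc : 2 ^ k < W.card := by
    rw [hW, Finset.card_union_of_disjoint (by simpa using hx), hZc]
    simp
  have hsum : W + W ⊆ ((X + X) ∪ X.image (x + ·)) ∪ (Z \ X).image (x + ·) := by
    have hZZ : Z + Z ⊆ X + X := by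
      intro u hu
      obtain ⟨y, hy, z, hz, rfl⟩ := Finset.mem_add.1 hu
      obtain ⟨a, ha, s, hs, rfl⟩ := Finset.mem_add.1 hy
      obtain ⟨b, hb, t, ht, rfl⟩ := Finset.mem_add.1 hz
      rw [mem_subgroupFinset] at hs ht
      have e : a + s + (b + t) = s + (t + (a + b)) := by abel
      rw [e]
      exact mem_translateStab.1 hs _ (mem_translateStab.1 ht _ (Finset.add_mem_add ha hb))
    have hxz : ∀ z ∈ Z, x + z ∈ ((X + X) ∪ X.image (x + ·)) ∪ (Z \ X).image (x + ·) := by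
      intro z hz
      by_cases hzX : z ∈ X
      · exact Finset.mem_union_left _ (Finset.mem_union_right _ (Finset.mem_image_of_mem _ hzX))
      · exact Finset.mem_union_right _ (Finset.mem_image_of_mem _ (by simp [hz, hzX]))
    intro u hu
    obtain ⟨y, hy, z, hz, rfl⟩ := Finset.mem_add.1 hu
    rw [hW, Finset.mem_union, Finset.mem_singleton] at hy hz
    rcases hy with hy | rfl <;> rcases hz with hz | rfl
    · exact Finset.mem_union_left _ (Finset.mem_union_left _ (hZZ (Finset.add_mem_add hy hz)))
    · rw [add_comm y z]
      exact hxz _ hy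
    · exact hxz _ hz
    · obtain ⟨u, hu⟩ := hX
      have := Finset.add_mem_add hu hu
      rw [ZModModule.add_self] at this ⊢
      exact Finset.mem_union_left _ (Finset.mem_union_left _ this)
  have h6 := two_pow_succ_le_card_add_self hWc
  have h7 := (Finset.card_le_card hsum).trans (Finset.card_union_le _ _)
  have h8 : ((Z \ X).image (x + ·)).card ≤ (Z \ X).card := Finset.card_image_le
  have h9 : (Z \ X).card + X.card = Z.card :=
    Finset.card_sdiff_add_card_eq_card (subset_add_subgroupFinset H X)
  omega

end Periodic

/-! ### Expansion under addition of a linearly independent set. -/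

section IndependentSum

open scoped Pointwise

/-- Double counting of inclusions F ⊆ F': each F has at least d extensions, each F' at most j + 1
subsets of size j. -/
lemma card_mul_le_card_mul_of_insert {α : Type*} [DecidableEq α] {E : Finset α}
    {𝒜 ℬ : Finset (Finset α)} {j d : ℕ} (hℬ : ∀ F ∈ ℬ, F.card = j + 1)
    (h𝒜 : ∀ F ∈ 𝒜, F.card = j ∧ d ≤ (E.filter fun e => e ∉ F ∧ insert e F ∈ ℬ).card) :
    𝒜.card * d ≤ ℬ.card * (j + 1) := by
  classical
  refine Finset.card_mul_le_card_mul (fun F F' => F ⊆ F') (fun F hF => ?_) fun F' hF' => ?_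
  · refine (h𝒜 F hF).2.trans (Finset.card_le_card_of_injOn (fun e => insert e F) ?_ ?_)
    · intro e he
      simp only [Finset.coe_filter, Set.mem_ofPred_eq] at he
      simp only [Finset.mem_coe, Finset.mem_bipartiteAbove]
      exact ⟨he.2.2, Finset.subset_insert _ _⟩
    · intro e he e' he' h
      simp only [Finset.coe_filter, Set.mem_ofPred_eq] at he he'
      have h1 : e ∈ insert e' F := by
        have := Finset.mem_insert_self e F
        rwa [show insert e F = insert e' F from h] at this
      rcases Finset.mem_insert.1 h1 with h2 | h2
      · exact h2
      · exact absurd h2 he.2.1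
  · have : Finset.bipartiteBelow (fun F F' => F ⊆ F') 𝒜 F' ⊆ F'.powersetCard j := by
      intro F hF
      rw [Finset.mem_bipartiteBelow] at hF
      exact Finset.mem_powersetCard.2 ⟨hF.2, (h𝒜 F hF.1).1⟩
    refine (Finset.card_le_card this).trans ?_
    rw [Finset.card_powersetCard, hℬ F' hF', Nat.choose_succ_self_right]

variable {G : Type*} [AddCommGroup G] [Module (ZMod 2) G] [DecidableEq G]

lemma sum_injOn_of_linearIndepOn {E : Finset G} (hE : LinearIndepOn (ZMod 2) id (E : Set G))
    {F F' : Finset G} (hF : F ⊆ E) (hF' : F' ⊆ E) (h : ∑ e ∈ F, e = ∑ e ∈ F', e) : F = F' := by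
  have key := linearIndepOn_finset_iff.1 hE
    (fun e => (if e ∈ F then 1 else 0) - (if e ∈ F' then 1 else 0)) (by
      simp only [id, sub_smul, ite_smul, one_smul, zero_smul, Finset.sum_sub_distrib]
      rw [← Finset.sum_filter, ← Finset.sum_filter, Finset.filter_mem_eq_inter,
        Finset.filter_mem_eq_inter, Finset.inter_eq_right.2 hF, Finset.inter_eq_right.2 hF', h,
        sub_self])
  ext e
  by_cases he : e ∈ E
  · have := key e he
    by_cases h1 : e ∈ F <;> by_cases h2 : e ∈ F' <;> simp_all
  · exact ⟨fun h => absurd (hF h) he, fun h => absurd (hF' h) he⟩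

/-- A dense bipartite graph contains a nonempty subgraph of large minimum degree; here for the graph
joining `x` to `x + e`. -/
lemma exists_subset_min_degree {X E B : Finset G} {s : ℕ} (hX : X.Nonempty) (hE : E.Nonempty)
    (hB : ∀ x ∈ X, ∀ e ∈ E, x + e ∈ B) (hs : B.card ≤ s) :
    ∃ X' ⊆ X, ∃ B' ⊆ B, X'.Nonempty ∧
      (∀ x ∈ X', E.card ≤ 4 * (E.filter fun e => x + e ∈ B').card) ∧
      ∀ b ∈ B', E.card * X.card ≤ 4 * s * (E.filter fun e => b + e ∈ X').card := by
  classical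
  set r := E.card with hr
  set m := X.card with hm
  let N : Finset G → Finset G → ℕ := fun X' B' => ((X' ×ˢ E).filter fun p => p.1 + p.2 ∈ B').card
  -- At a maximum of this potential, deleting a vertex cannot increase it, which is exactly the pair
  -- of degree bounds. The potential is positive at (X, B), so a maximizer has edges.
  let f : Finset G × Finset G → ℤ := fun p => 4 * s * N p.1 p.2 - r * s * p.1.card - r * m * p.2.card
  obtain ⟨⟨X', B'⟩, hmem, hmax⟩ := Finset.exists_max_image (X.powerset ×ˢ B.powerset) f
    ⟨(X, B), by simp⟩
  simp only [Finset.mem_product, Finset.mem_powerset] at hmem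
  have hfull : N X B = m * r := by
    simp only [N]
    rw [Finset.filter_true_of_mem, Finset.card_product]
    intro p hp
    rw [Finset.mem_product] at hp
    exact hB _ hp.1 _ hp.2
  have hm0 : 0 < m := hX.card_pos
  have hr0 : 0 < r := hE.card_pos
  have hs0 : 0 < s := by
    obtain ⟨x, hx⟩ := hX
    obtain ⟨e, he⟩ := hE
    exact (Finset.card_pos.2 ⟨_, hB x hx e he⟩).trans_le hs
  have hpos : 0 < f (X', B') := by
    refine lt_of_lt_of_le ?_ (hmax (X, B) (by simp))
    simp only [f, hfull, ← hm]
    have h1 : (r * m * B.card : ℤ) ≤ r * m * s := by exact_mod_cast Nat.mul_le_mul_left _ hs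
    have h2 : (0 : ℤ) < r * m * s := by positivity
    push_cast
    nlinarith
  have hne : X'.Nonempty := by
    rw [Finset.nonempty_iff_ne_empty]
    rintro rfl
    simp only [f, N, Finset.empty_product, Finset.filter_empty, Finset.card_empty] at hpos
    have : (0 : ℤ) ≤ r * m * B'.card := by positivity
    push_cast at hpos
    linarith
  refine ⟨X', hmem.1, B', hmem.2, hne, fun x hx => ?_, fun b hb => ?_⟩
  · have h1 := hmax (X'.erase x, B') (by
      simp only [Finset.mem_product, Finset.mem_powerset]
      exact ⟨(Finset.erase_subset _ _).trans hmem.1, hmem.2⟩)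
    have h2 : N X' B' = N (X'.erase x) B' + (E.filter fun e => x + e ∈ B').card := by
      simp only [N]
      have : X' ×ˢ E = (X'.erase x) ×ˢ E ∪ ({x} : Finset G) ×ˢ E := by
        rw [← Finset.union_product]
        congr 1
        ext y
        by_cases hy : y = x <;> simp [hy, hx]
      rw [this, Finset.filter_union, Finset.card_union_of_disjoint]
      · congr 1
        refine Finset.card_bij (fun p _ => p.2) ?_ ?_ ?_
        · rintro ⟨a, e⟩ h
          simp only [Finset.mem_filter, Finset.mem_product, Finset.mem_singleton] at h
          simp only [Finset.mem_filter]
          exact ⟨h.1.2, h.1.1 ▸ h.2⟩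
        · rintro ⟨a, e⟩ h ⟨a', e'⟩ h' hh
          simp only [Finset.mem_filter, Finset.mem_product, Finset.mem_singleton] at h h'
          exact Prod.ext (h.1.1.trans h'.1.1.symm) hh
        · intro e he
          rw [Finset.mem_filter] at he
          exact ⟨(x, e), by simp [he.1, he.2], rfl⟩
      · rw [Finset.disjoint_left]
        rintro ⟨a, e⟩ h h'
        simp only [Finset.mem_filter, Finset.mem_product, Finset.mem_singleton,
          Finset.mem_erase] at h h'
        exact h.1.1.1 h'.1.1
    have h3 : (X'.erase x).card + 1 = X'.card := Finset.card_erase_add_one hx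
    simp only [f] at h1
    rw [h2, ← h3] at h1
    push_cast at h1
    have h4 : (s : ℤ) * r ≤ s * (4 * (E.filter fun e => x + e ∈ B').card) := by nlinarith
    have h5 : s * r ≤ s * (4 * (E.filter fun e => x + e ∈ B').card) := by exact_mod_cast h4
    exact Nat.le_of_mul_le_mul_left h5 hs0
  · have h1 := hmax (X', B'.erase b) (by
      simp only [Finset.mem_product, Finset.mem_powerset]
      exact ⟨hmem.1, (Finset.erase_subset _ _).trans hmem.2⟩)
    have h2 : N X' B' = N X' (B'.erase b) + (E.filter fun e => b + e ∈ X').card := by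
      simp only [N]
      have : ((X' ×ˢ E).filter fun p => p.1 + p.2 ∈ B') =
          ((X' ×ˢ E).filter fun p => p.1 + p.2 ∈ B'.erase b) ∪
            ((X' ×ˢ E).filter fun p => p.1 + p.2 = b) := by
        rw [← Finset.filter_or]
        refine Finset.filter_congr fun p _ => ?_
        by_cases hy : p.1 + p.2 = b <;> simp [hy, hb]
      rw [this, Finset.card_union_of_disjoint]
      · congr 1
        refine Finset.card_bij (fun p _ => p.2) ?_ ?_ ?_
        · rintro ⟨a, e⟩ h
          simp only [Finset.mem_filter, Finset.mem_product] at h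
          simp only [Finset.mem_filter]
          refine ⟨h.1.2, ?_⟩
          rw [← h.2, add_assoc, ZModModule.add_self, add_zero]
          exact h.1.1
        · rintro ⟨a, e⟩ h ⟨a', e'⟩ h' hh
          simp only [Finset.mem_filter, Finset.mem_product] at h h'
          have hh' : e = e' := hh
          subst hh'
          exact Prod.ext (add_right_cancel (h.2.trans h'.2.symm)) rfl
        · intro e he
          rw [Finset.mem_filter] at he
          exact ⟨(b + e, e), by simp [he.1, he.2, add_assoc, ZModModule.add_self], rfl⟩
      · rw [Finset.disjoint_left]
        rintro ⟨a, e⟩ h h'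
        simp only [Finset.mem_filter, Finset.mem_erase] at h h'
        exact h.2.1 h'.2
    have h3 : (B'.erase b).card + 1 = B'.card := Finset.card_erase_add_one hb
    simp only [f] at h1
    rw [h2, ← h3] at h1
    push_cast at h1
    have h4 : (r : ℤ) * m ≤ 4 * s * (E.filter fun e => b + e ∈ X').card := by nlinarith
    exact_mod_cast h4

/-- Adding a large independent set expands: a bound in the spirit of vertex isoperimetry in the
hypercube. -/
lemma pow_card_add_le_of_linearIndepOn {X E : Finset G} {s l : ℕ} (hX : X.Nonempty)
    (hE : LinearIndepOn (ZMod 2) id (E : Set G)) (hs : (X + E).card ≤ s)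
    (hl : 16 * l * s ≤ E.card * X.card) : s ^ l ≤ X.card * X.card ^ l := by
  classical
  have hm0 : 0 < X.card := hX.card_pos
  rcases Nat.eq_zero_or_pos l with rfl | hl0
  · simpa using hm0
  rcases Nat.eq_zero_or_pos s with rfl | hs0
  · rw [zero_pow hl0.ne']
    exact Nat.zero_le _
  have hEne : E.Nonempty := by
    rw [← Finset.card_pos]
    by_contra h
    have : E.card = 0 := by omega
    rw [this, zero_mul] at hl
    have : 0 < 16 * l * s := by positivity
    omega
  obtain ⟨X', hX', B', hB', ⟨x₀, hx₀⟩, hdX, hdB⟩ := exists_subset_min_degree (B := X + E) hX hEne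
    (fun x hx e he => Finset.add_mem_add hx he) hs
  set r := E.card with hr
  set m := X.card with hm
  have hms : m ≤ s := by
    obtain ⟨e, he⟩ := hEne
    refine le_trans (Finset.card_le_card_of_injOn (fun x => x + e) ?_ ?_) hs
    · intro x hx
      exact Finset.add_mem_add hx he
    · intro x _ y _ h
      exact add_right_cancel h
  have hlr : 16 * l ≤ r := by
    refine Nat.le_of_mul_le_mul_right (hl.trans (Nat.mul_le_mul_left r hms)) hs0
  -- Walks from x₀ through the bipartite graph that use each element of E at most once, recorded by
  -- the set F of elements used. Independence makes the endpoints of different F distinct, so |X|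
  -- bounds the number of those ending in X'.
  let Q : Finset G → ℕ → Finset (Finset G) := fun T j =>
    (E.powersetCard j).filter fun F => x₀ + ∑ e ∈ F, e ∈ T
  have hQc : ∀ T j, ∀ F ∈ Q T j, F ⊆ E ∧ F.card = j ∧ x₀ + ∑ e ∈ F, e ∈ T := by
    intro T j F hF
    simp only [Q, Finset.mem_filter, Finset.mem_powersetCard] at hF
    exact ⟨hF.1.1, hF.1.2, hF.2⟩
  have step : ∀ (S T : Finset G) (j d : ℕ),
      (∀ x ∈ S, d + j ≤ (E.filter fun e => x + e ∈ T).card) →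
      (Q S j).card * d ≤ (Q T (j + 1)).card * (j + 1) := by
    intro S T j d hd
    refine card_mul_le_card_mul_of_insert (E := E) (fun F hF => (hQc _ _ F hF).2.1) fun F hF => ?_
    obtain ⟨hFE, hFc, hFS⟩ := hQc _ _ F hF
    refine ⟨hFc, ?_⟩
    have h1 := hd _ hFS
    have h2 : (E.filter fun e => x₀ + ∑ e ∈ F, e + e ∈ T) ⊆
        (E.filter fun e => e ∉ F ∧ insert e F ∈ Q T (j + 1)) ∪ F := by
      intro e he
      rw [Finset.mem_filter] at he
      by_cases heF : e ∈ F
      · exact Finset.mem_union_right _ heF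
      · refine Finset.mem_union_left _ ?_
        simp only [Q, Finset.mem_filter, Finset.mem_powersetCard]
        refine ⟨he.1, heF, ⟨Finset.insert_subset he.1 hFE, by
          rw [Finset.card_insert_of_notMem heF, hFc]⟩, ?_⟩
        rw [Finset.sum_insert heF, add_comm e, ← add_assoc]
        exact he.2
    have h3 := (Finset.card_le_card h2).trans (Finset.card_union_le _ _)
    omega
  -- Two steps gain a factor s/m. From X' the degree is at least r/4, and at least r/8 remains after
  -- discarding the 2i elements already used; from B' the degree is at least 4l, so that the return
  -- step loses nothing.
  have main : ∀ i ≤ l, s ^ i ≤ (Q X' (2 * i)).card * m ^ i := by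
    intro i
    induction i with
    | zero =>
      intro _
      have : (∅ : Finset G) ∈ Q X' 0 := by simp [Q, hx₀]
      simpa using Finset.card_pos.2 ⟨_, this⟩
    | succ i ih =>
      intro hi
      have ih := ih (by omega)
      set d₁ := (r + 7) / 8 with hd₁
      have s1 : (Q X' (2 * i)).card * d₁ ≤ (Q B' (2 * i + 1)).card * (2 * i + 1) := by
        refine step _ _ _ _ fun x hx => ?_
        have := hdX x hx
        omega
      have s2 : (Q B' (2 * i + 1)).card * (2 * i + 2) ≤ (Q X' (2 * i + 2)).card * (2 * i + 2) := by
        refine step _ _ _ _ fun b hb => ?_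
        have h1 := hl.trans (hdB b hb)
        have h2 : 4 * s * (4 * l) ≤ 4 * s * (E.filter fun e => b + e ∈ X').card := by
          refine le_trans (le_of_eq (by ring)) h1
        have := Nat.le_of_mul_le_mul_left h2 (by positivity)
        omega
      have s3 := Nat.le_of_mul_le_mul_right s2 (by positivity)
      have h8 : r ≤ 8 * d₁ := by omega
      have s4 : (2 * i + 1) * s ≤ d₁ * m := by
        have a1 : 16 * l * s ≤ 8 * d₁ * m := hl.trans (Nat.mul_le_mul_right _ h8)
        have a2 : (2 * i + 1) * s ≤ (2 * l) * s := Nat.mul_le_mul_right _ (by omega)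
        nlinarith
      have s5 : (Q X' (2 * i)).card * s ≤ (Q X' (2 * i + 2)).card * m := by
        refine Nat.le_of_mul_le_mul_left (c := 2 * i + 1) ?_ (by positivity)
        calc (2 * i + 1) * ((Q X' (2 * i)).card * s) = (Q X' (2 * i)).card * ((2 * i + 1) * s) := by
              ring
          _ ≤ (Q X' (2 * i)).card * (d₁ * m) := Nat.mul_le_mul_left _ s4
          _ = (Q X' (2 * i)).card * d₁ * m := by ring
          _ ≤ (Q B' (2 * i + 1)).card * (2 * i + 1) * m := Nat.mul_le_mul_right _ s1
          _ ≤ (Q X' (2 * i + 2)).card * (2 * i + 1) * m :=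
              Nat.mul_le_mul_right _ (Nat.mul_le_mul_right _ s3)
          _ = (2 * i + 1) * ((Q X' (2 * i + 2)).card * m) := by ring
      calc s ^ (i + 1) = s ^ i * s := pow_succ _ _
        _ ≤ (Q X' (2 * i)).card * m ^ i * s := Nat.mul_le_mul_right _ ih
        _ = (Q X' (2 * i)).card * s * m ^ i := by ring
        _ ≤ (Q X' (2 * i + 2)).card * m * m ^ i := Nat.mul_le_mul_right _ s5
        _ = (Q X' (2 * (i + 1))).card * m ^ (i + 1) := by
            rw [pow_succ, show 2 * (i + 1) = 2 * i + 2 by ring]; ring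
  refine (main l le_rfl).trans (Nat.mul_le_mul_right _ ?_)
  refine le_trans (Finset.card_le_card_of_injOn (t := X') (fun F => x₀ + ∑ e ∈ F, e) ?_ ?_)
    (Finset.card_le_card hX')
  · intro F hF
    exact (hQc _ _ F hF).2.2
  · intro F hF F' hF' h
    exact sum_injOn_of_linearIndepOn hE (hQc _ _ F hF).1 (hQc _ _ F' hF').1 (add_left_cancel h)

end IndependentSum

/-! ### Counting sets of large doubling by containers. -/

section Containers

open scoped Pointwise

/-- One term of the binomial expansion of (1 + 2^(-a))^N, together with 1 + x ≤ exp x. The free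
parameter a trades the two factors against each other. -/
lemma choose_le_two_pow_mul_exp (N j a : ℕ) :
    (N.choose j : ℝ) ≤ 2 ^ (a * j) * Real.exp (N / 2 ^ a) := by
  have h0 : (0 : ℝ) < 2 ^ a := by positivity
  rcases Nat.lt_or_ge N j with h | h
  · rw [Nat.choose_eq_zero_of_lt h, Nat.cast_zero]
    positivity
  have h1 : ((1 / 2 ^ a : ℝ)) ^ j * N.choose j ≤ (1 / 2 ^ a + 1) ^ N := by
    rw [add_pow]
    refine le_trans (le_of_eq (by simp)) (Finset.single_le_sum (f := fun i =>
      (1 / 2 ^ a : ℝ) ^ i * 1 ^ (N - i) * N.choose i) (fun i _ => by positivity)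
      (Finset.mem_range.2 (Nat.lt_succ_of_le h)))
  have h2 : (1 / 2 ^ a + 1 : ℝ) ^ N ≤ Real.exp (N / 2 ^ a) := by
    calc (1 / 2 ^ a + 1 : ℝ) ^ N ≤ (Real.exp (1 / 2 ^ a)) ^ N :=
          pow_le_pow_left₀ (by positivity) (Real.add_one_le_exp _) _
      _ = Real.exp (N / 2 ^ a) := by rw [← Real.exp_nat_mul]; congr 1; ring
  have h3 : (N.choose j : ℝ) = 2 ^ (a * j) * ((1 / 2 ^ a : ℝ) ^ j * N.choose j) := by
    rw [← mul_assoc, pow_mul, ← mul_pow]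
    field_simp
    simp
  rw [h3]
  exact mul_le_mul_of_nonneg_left (h1.trans h2) (by positivity)

/-- Repeated values pad an enumeration to length exactly t, so sets of at most t elements can be
counted as functions on `Fin t`. -/
lemma Finset.exists_fin_image_eq {α : Type*} [DecidableEq α] {Y : Finset α} {t : ℕ}
    (hY : Y.Nonempty) (ht : Y.card ≤ t) : ∃ f : Fin t → α, Finset.univ.image f = Y := by
  classical
  obtain ⟨y₀, hy₀⟩ := hY
  refine ⟨fun i => if h : i.1 < Y.card then (Y.equivFin.symm ⟨i, h⟩ : α) else y₀, ?_⟩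
  ext y
  rw [Finset.mem_image]
  constructor
  · rintro ⟨i, _, rfl⟩
    split_ifs with h
    · exact (Y.equivFin.symm ⟨i, h⟩).2
    · exact hy₀
  · intro hy
    refine ⟨⟨Y.equivFin ⟨y, hy⟩, (Y.equivFin ⟨y, hy⟩).2.trans_le ht⟩, Finset.mem_univ _, ?_⟩
    simp

variable {G : Type*} [AddCommGroup G] [Fintype G] [DecidableEq G]

set_option linter.unusedSectionVars false

/-- A set that has been enlarged greedily, at a gain of at least `T` new sums for each new
element, until no element of `X` gives such a gain. -/
lemma exists_subset_card_sdiff_add_le {X : Finset G} {T : ℕ} (hT : 2 * T ≤ X.card) :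
    ∃ Y ⊆ X, 2 * T ≤ Y.card ∧ Y.card * T ≤ 2 * T * T + (Y + Y).card ∧
      ∀ x ∈ X, (Y.filter fun y => x + y ∉ Y + Y).card ≤ T := by
  classical
  obtain ⟨Y₀, hY₀, hc₀⟩ := Finset.exists_subset_card_eq hT
  let S := X.powerset.filter fun Y => 2 * T ≤ Y.card ∧ Y.card * T ≤ 2 * T * T + (Y + Y).card
  have hS : S.Nonempty := ⟨Y₀, by
    simp only [S, Finset.mem_filter, Finset.mem_powerset]
    exact ⟨hY₀, hc₀.ge, by rw [hc₀]; omega⟩⟩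
  obtain ⟨Y, hY, hmax⟩ := Finset.exists_max_image S Finset.card hS
  simp only [S, Finset.mem_filter, Finset.mem_powerset] at hY
  refine ⟨Y, hY.1, hY.2.1, hY.2.2, fun x hx => ?_⟩
  by_contra hcon
  push Not at hcon
  have hxY : x ∉ Y := fun hxY => by
    rw [Finset.filter_false_of_mem] at hcon
    · simp at hcon
    · intro y hy h
      exact h (Finset.add_mem_add hxY hy)
  have h1 : (Y + Y) ∪ (Y.filter fun y => x + y ∉ Y + Y).image (x + ·) ⊆
      insert x Y + insert x Y := by
    refine Finset.union_subset (Finset.add_subset_add (Finset.subset_insert _ _)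
      (Finset.subset_insert _ _)) fun z hz => ?_
    obtain ⟨y, hy, rfl⟩ := Finset.mem_image.1 hz
    rw [Finset.mem_filter] at hy
    exact Finset.add_mem_add (Finset.mem_insert_self _ _) (Finset.mem_insert_of_mem hy.1)
  have h2 := Finset.card_le_card h1
  rw [Finset.card_union_of_disjoint, Finset.card_image_of_injective _ (add_right_injective x)] at h2
  · have h3 := hmax (insert x Y) (by
      simp only [S, Finset.mem_filter, Finset.mem_powerset]
      rw [Finset.card_insert_of_notMem hxY]
      refine ⟨Finset.insert_subset hx hY.1, by omega, ?_⟩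
      rw [add_mul, one_mul]
      omega)
    rw [Finset.card_insert_of_notMem hxY] at h3
    omega
  · rw [Finset.disjoint_right]
    intro z hz
    obtain ⟨y, hy, rfl⟩ := Finset.mem_image.1 hz
    exact (Finset.mem_filter.1 hy).2

/-- The elements `p` such that at least half of `p + Y` lies in `Y + Y`. -/
def sumContainer (Y : Finset G) : Finset G :=
  Finset.univ.filter fun p => Y.card ≤ 2 * (Y.filter fun y => p + y ∈ Y + Y).card

/-- Exactly |Y| |Y + Y| pairs (p, y) have p + y ∈ Y + Y, and each member of the container accounts
for at least |Y| / 2 of them. -/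
lemma card_sumContainer_le {Y : Finset G} (hY : Y.Nonempty) :
    (sumContainer Y).card ≤ 2 * (Y + Y).card := by
  have h1 : (sumContainer Y).card * Y.card ≤
      ∑ p : G, 2 * (Y.filter fun y => p + y ∈ Y + Y).card := by
    rw [← smul_eq_mul, ← Finset.sum_const]
    refine (Finset.sum_le_sum fun p hp => ?_).trans
      (Finset.sum_le_sum_of_subset (Finset.subset_univ (sumContainer Y)))
    exact (Finset.mem_filter.1 hp).2
  have h2 : ∑ p : G, 2 * (Y.filter fun y => p + y ∈ Y + Y).card = 2 * (Y + Y).card * Y.card := by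
    rw [← Finset.mul_sum, mul_assoc]
    congr 1
    simp_rw [Finset.card_filter]
    rw [Finset.sum_comm, mul_comm, ← smul_eq_mul, ← Finset.sum_const]
    refine Finset.sum_congr rfl fun y _ => ?_
    rw [← Finset.card_filter]
    refine Finset.card_bij (fun p _ => p + y) ?_ ?_ ?_
    · intro p hp
      exact (Finset.mem_filter.1 hp).2
    · intro p _ q _ h
      exact add_right_cancel h
    · intro z hz
      exact ⟨z - y, by simpa using hz, by abel⟩
  rw [h2] at h1
  exact Nat.le_of_mul_le_mul_right h1 hY.card_pos

lemma subset_sumContainer {X Y : Finset G} {T : ℕ} (hT : 2 * T ≤ Y.card)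
    (h : ∀ x ∈ X, (Y.filter fun y => x + y ∉ Y + Y).card ≤ T) : X ⊆ sumContainer Y := by
  intro x hx
  have h1 := h x hx
  have h2 := Finset.card_filter_add_card_filter_not (s := Y) (fun y => x + y ∈ Y + Y)
  simp only [sumContainer, Finset.mem_filter, Finset.mem_univ, true_and]
  omega

variable [Module (ZMod 2) G]

lemma exists_finset_linearIndepOn_subset_span (X : Finset G) : ∃ E ⊆ X,
    LinearIndepOn (ZMod 2) id (E : Set G) ∧
      (X : Set G) ⊆ Submodule.span (ZMod 2) (E : Set G) := by
  obtain ⟨E, hE, _, hsp, hli⟩ :=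
    Submodule.exists_finset_span_eq_linearIndepOn (ZMod 2) (X : Set G)
  exact ⟨E, by simpa using hE, hli, hsp ▸ Submodule.subset_span⟩

/-- Linear combinations over `𝔽₂`. -/
def linComb {R : ℕ} (v : Fin R → G) (c : Fin R → ZMod 2) : G := ∑ i, c i • v i

lemma exists_linComb_eq {E : Finset G} {R : ℕ} (hE : E.card ≤ R) :
    ∃ v : Fin R → G, ∀ x ∈ Submodule.span (ZMod 2) (E : Set G), ∃ c, linComb v c = x := by
  classical
  have key : ∃ v : Fin R → G, (E : Set G) ⊆ Set.range v := by
    rcases E.eq_empty_or_nonempty with rfl | hne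
    · exact ⟨0, by simp⟩
    · obtain ⟨v, hv⟩ := Finset.exists_fin_image_eq hne hE
      refine ⟨v, fun x hx => ?_⟩
      rw [← hv] at hx
      simpa using hx
  obtain ⟨v, hv⟩ := key
  exact ⟨v, fun x hx => (Submodule.mem_span_range_iff_exists_fun (ZMod 2)).1
    (Submodule.span_mono hv hx)⟩

/-- The set with the given coordinates with respect to `v`. -/
def linCombImage {R t : ℕ} (v : Fin R → G) (y : Fin t → Fin R → ZMod 2) : Finset G :=
  Finset.univ.image fun i => linComb v (y i)

lemma exists_linCombImage_eq {R t : ℕ} {v : Fin R → G} {Y : Finset G}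
    (hv : ∀ x ∈ Y, ∃ c, linComb v c = x) (hY : Y.Nonempty) (ht : Y.card ≤ t) :
    ∃ y : Fin t → Fin R → ZMod 2, linCombImage v y = Y := by
  obtain ⟨f, hf⟩ := Finset.exists_fin_image_eq hY ht
  have : ∀ i, ∃ c, linComb v c = f i := fun i =>
    hv _ (hf ▸ Finset.mem_image_of_mem f (Finset.mem_univ i))
  choose y hy using this
  refine ⟨y, ?_⟩
  rw [linCombImage, ← hf]
  congr 1
  exact funext hy

/-- The R generators cost n bits each; after that every element costs only R bits. This saving is
why rank bounds matter. -/
lemma card_coordinates (R t n : ℕ) (hn : Fintype.card G = 2 ^ n) :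
    Fintype.card ((Fin R → G) × (Fin t → Fin R → ZMod 2)) = 2 ^ (n * R + R * t) := by
  rw [Fintype.card_prod, Fintype.card_fun, Fintype.card_fun, Fintype.card_fun, hn]
  simp only [Fintype.card_fin, ZMod.card]
  rw [pow_add, pow_mul, pow_mul]

lemma card_le_of_subset_sumContainer {n R t m N : ℕ} (hn : Fintype.card G = 2 ^ n)
    (ℱ : Finset (Finset G)) (h : ∀ X ∈ ℱ, X.card = m ∧
      ∃ (v : Fin R → G) (y : Fin t → Fin R → ZMod 2), X ⊆ sumContainer (linCombImage v y) ∧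
        (sumContainer (linCombImage v y)).card ≤ N) :
    ℱ.card ≤ 2 ^ (n * R + R * t) * N.choose m := by
  classical
  let P : (Fin R → G) × (Fin t → Fin R → ZMod 2) → Finset (Finset G) := fun p =>
    if (sumContainer (linCombImage p.1 p.2)).card ≤ N then
      (sumContainer (linCombImage p.1 p.2)).powersetCard m else ∅
  have h1 : ℱ ⊆ Finset.univ.biUnion P := by
    intro X hX
    obtain ⟨hc, v, y, hs, hN⟩ := h X hX
    rw [Finset.mem_biUnion]
    refine ⟨(v, y), Finset.mem_univ _, ?_⟩
    simp only [P, if_pos hN]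
    exact Finset.mem_powersetCard.2 ⟨hs, hc⟩
  refine (Finset.card_le_card h1).trans ((Finset.card_biUnion_le_card_mul _ _ (N.choose m)
    fun p _ => ?_).trans (le_of_eq ?_))
  · simp only [P]
    split_ifs with hN
    · rw [Finset.card_powersetCard]
      exact Nat.choose_le_choose _ hN
    · simp
  · rw [Finset.card_univ, card_coordinates R t n hn]

/-- Sets with large doubling have small rank. -/
lemma card_linearIndepOn_mul_le {n k s p : ℕ} (hp : 2 ^ 16 ≤ p) (hk : 2 ^ 15 ≤ k)
    (hnk : n * k ≤ 2 ^ (k + 1))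
    {X E : Finset G} (hXc : X.card = 2 ^ k + 1) (hEX : E ⊆ X) (hXs : (X + X).card = s)
    (hE : LinearIndepOn (ZMod 2) id (E : Set G)) (hs : 2 ^ p * X.card ≤ s) :
    1024 * n * E.card ≤ s := by
  by_contra hcon
  push Not at hcon
  have hXne : X.Nonempty := Finset.card_pos.1 (by omega)
  have hXE : (X + E).card ≤ s := hXs ▸ Finset.card_le_card (Finset.add_subset_add_left hEX)
  -- If the rank exceeded s / (1024 n), expansion with this l would give 2^(pl) ≤ |X| = 2^k + 1,
  -- whereas p ≥ 2^16 forces pl > k.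
  obtain ⟨l, hl⟩ : ∃ l, l = k / 2 ^ 15 := ⟨_, rfl⟩
  have hl1 : 2 ^ 15 * l ≤ k := by rw [hl]; exact Nat.mul_div_le _ _
  have hl2 : k < 2 ^ 15 * (l + 1) := by rw [hl]; exact Nat.lt_mul_div_succ _ (by norm_num)
  have hl0 : 1 ≤ l := by omega
  have h1 : 16 * l * s ≤ E.card * X.card := by
    have a1 : n * k ≤ 2 * X.card := by rw [hXc]; rw [pow_succ] at hnk; omega
    have a2 : s * k ≤ 1024 * (n * k) * E.card := by
      calc s * k ≤ 1024 * n * E.card * k := Nat.mul_le_mul_right _ hcon.le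
        _ = 1024 * (n * k) * E.card := by ring
    have a3 : 1024 * (n * k) * E.card ≤ 1024 * (2 * X.card) * E.card := by gcongr
    have a4 : s * (2 ^ 15 * l) ≤ s * k := Nat.mul_le_mul_left _ hl1
    nlinarith
  have h2 := pow_card_add_le_of_linearIndepOn hXne hE hXE h1
  have h3 : 2 ^ (p * l) * X.card ^ l ≤ X.card * X.card ^ l := by
    rw [pow_mul, ← mul_pow]
    exact (Nat.pow_le_pow_left hs l).trans h2
  have h4 := Nat.le_of_mul_le_mul_right h3 (pow_pos hXne.card_pos l)
  have h5 : 2 ^ (p * l) < 2 ^ (k + 1) := by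
    have : 0 < k := by omega
    have : 1 < 2 ^ k := Nat.one_lt_two_pow (by omega)
    rw [hXc] at h4
    rw [pow_succ]
    omega
  have h6 := (Nat.pow_lt_pow_iff_right (by norm_num)).1 h5
  have h7 := Nat.mul_le_mul_right l hp
  omega

lemma exp_le_two_rpow {x : ℝ} (hx : 0 ≤ x) : Real.exp x ≤ 2 ^ (2 * x) := by
  rw [Real.rpow_def_of_pos (by norm_num)]
  refine Real.exp_le_exp.2 ?_
  nlinarith [Real.log_two_gt_d9]

/-- There are few sets with large doubling. -/
theorem card_filter_card_add_self_eq_le {n k s p : ℕ} (hn : Fintype.card G = 2 ^ n)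
    (hp : 2 ^ 16 ≤ p) (hk : 2 ^ 15 ≤ k) (hnk : n * k ≤ 2 ^ (k + 1))
    (hs : 2 ^ p * (2 ^ k + 1) ≤ s) :
    ((Finset.univ.filter fun X : Finset G => X.card = 2 ^ k + 1 ∧ (X + X).card = s).card : ℝ) ≤
      2 ^ ((s : ℝ) / 2) := by
  classical
  obtain ⟨R, hR⟩ : ∃ R, R = min (s / (1024 * n)) n := ⟨_, rfl⟩
  -- The greedy threshold will be T = 16R: the set Y then has at most 2T + s/T = t elements, costing
  -- Rt ≤ 32nR + s/16 bits, where nR ≤ s/1024.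
  obtain ⟨t, ht⟩ : ∃ t, t = 32 * R + s / (16 * R) := ⟨_, rfl⟩
  have hRn : R ≤ n := hR ▸ min_le_right _ _
  have hRs : 1024 * (n * R) ≤ s := by
    have h1 : R ≤ s / (1024 * n) := hR ▸ min_le_left _ _
    calc 1024 * (n * R) = 1024 * n * R := by ring
      _ ≤ 1024 * n * (s / (1024 * n)) := Nat.mul_le_mul_left _ h1
      _ ≤ s := Nat.mul_div_le _ _
  have h32 : 32 * n ≤ 2 ^ k := by
    have h1 : n * 2 ^ 15 ≤ n * k := Nat.mul_le_mul_left _ hk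
    rw [pow_succ] at hnk
    omega
  have hcount : (Finset.univ.filter fun X : Finset G =>
      X.card = 2 ^ k + 1 ∧ (X + X).card = s).card ≤
      2 ^ (n * R + R * t) * (2 * s).choose (2 ^ k + 1) := by
    refine card_le_of_subset_sumContainer hn _ fun X hX => ?_
    simp only [Finset.mem_filter, Finset.mem_univ, true_and] at hX
    refine ⟨hX.1, ?_⟩
    obtain ⟨E, hEX, hE, hsp⟩ := exists_finset_linearIndepOn_subset_span X
    have hEs := card_linearIndepOn_mul_le hp hk hnk hX.1 hEX hX.2 hE (by rw [hX.1]; exact hs)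
    have hEn : E.card ≤ n := by
      have h1 : Fintype.card E ≤ Module.finrank (ZMod 2) G :=
        LinearIndependent.fintype_card_le_finrank (b := fun x : E => (x : G)) hE
      have h2 : Module.finrank (ZMod 2) G = n := by
        have := Module.card_eq_pow_finrank (K := ZMod 2) (V := G)
        rw [hn, ZMod.card] at this
        exact (Nat.pow_right_injective le_rfl this).symm
      rwa [Fintype.card_coe, h2] at h1
    have hEpos : 0 < E.card := by
      rw [Finset.card_pos, Finset.nonempty_iff_ne_empty]
      rintro rfl
      simp only [Finset.coe_empty, Submodule.span_empty, Submodule.bot_coe] at hsp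
      have h1 : X.card ≤ ({0} : Finset G).card := Finset.card_le_card fun x hx => by
        simpa using hsp hx
      have : 0 < 2 ^ k := by positivity
      rw [Finset.card_singleton, hX.1] at h1
      omega
    have hER : E.card ≤ R := by
      rw [hR]
      refine le_min ?_ hEn
      rw [Nat.le_div_iff_mul_le (by omega)]
      linarith
    have hRpos : 0 < R := hEpos.trans_le hER
    obtain ⟨v, hv⟩ := exists_linComb_eq hER
    obtain ⟨Y, hYX, hYc, hYT, hY⟩ := exists_subset_card_sdiff_add_le (X := X) (T := 16 * R)
      (by rw [hX.1]; omega)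
    have hYne : Y.Nonempty := Finset.card_pos.1 (by omega)
    have hYs : (Y + Y).card ≤ s := hX.2 ▸ Finset.card_le_card (Finset.add_subset_add hYX hYX)
    have hYt : Y.card ≤ t := by
      have h1 : Y.card ≤ (2 * (16 * R) * (16 * R) + s) / (16 * R) := by
        rw [Nat.le_div_iff_mul_le (by omega)]
        omega
      rwa [show 2 * (16 * R) * (16 * R) + s = s + (16 * R) * (32 * R) by ring,
        Nat.add_mul_div_left _ _ (by omega), add_comm, ← ht] at h1
    obtain ⟨y, hy⟩ := exists_linCombImage_eq (fun x hx => hv x (hsp (hYX hx))) hYne hYt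
    refine ⟨v, y, ?_, ?_⟩
    · rw [hy]
      exact subset_sumContainer hYc hY
    · rw [hy]
      exact (card_sumContainer_le hYne).trans (by omega)
  have hRt : R * t ≤ 32 * (n * R) + s / 16 := by
    rw [ht, mul_add]
    have h1 : R * (32 * R) ≤ 32 * (n * R) := by nlinarith
    have h2 : R * (s / (16 * R)) ≤ s / 16 := by
      rw [← Nat.div_div_eq_div_mul]
      exact Nat.mul_div_le _ _
    omega
  have hm : 256 * (2 ^ k + 1) ≤ s := by
    refine le_trans (Nat.mul_le_mul_right _ ?_) hs
    calc 256 = 2 ^ 8 := by norm_num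
      _ ≤ 2 ^ p := Nat.pow_le_pow_right (by norm_num) (le_trans (by norm_num) hp)
  have hch := choose_le_two_pow_mul_exp (2 * s) (2 ^ k + 1) 4
  have hex : Real.exp (((2 * s : ℕ) : ℝ) / 2 ^ 4) ≤ 2 ^ ((s : ℝ) / 4) := by
    refine (exp_le_two_rpow (by positivity)).trans (le_of_eq ?_)
    congr 1
    push_cast
    ring
  calc ((Finset.univ.filter fun X : Finset G =>
        X.card = 2 ^ k + 1 ∧ (X + X).card = s).card : ℝ)
      ≤ 2 ^ (n * R + R * t) * ((2 * s).choose (2 ^ k + 1) : ℝ) := by exact_mod_cast hcount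
    _ ≤ 2 ^ (n * R + R * t) * (2 ^ (4 * (2 ^ k + 1)) * 2 ^ ((s : ℝ) / 4)) := by
        gcongr
        exact hch.trans (by gcongr)
    _ = 2 ^ ((((n * R + R * t) + 4 * (2 ^ k + 1) : ℕ) : ℝ) + (s : ℝ) / 4) := by
        rw [Real.rpow_add (by norm_num), Real.rpow_natCast, pow_add _ (n * R + R * t), mul_assoc]
    _ ≤ 2 ^ ((s : ℝ) / 2) := by
        refine Real.rpow_le_rpow_of_exponent_le (by norm_num) ?_
        have : 4 * ((n * R + R * t) + 4 * (2 ^ k + 1)) ≤ s := by omega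
        have : (4 * ((n * R + R * t + 4 * (2 ^ k + 1) : ℕ) : ℝ)) ≤ s := by exact_mod_cast this
        linarith

end Containers

/-! ### Small doubling: rank bounds and random sampling. -/

section SmallDoubling

open scoped Pointwise

variable {G : Type*} [AddCommGroup G] [Fintype G] [DecidableEq G] [Module (ZMod 2) G]

set_option linter.unusedSectionVars false

lemma sum_add_mem_image_powerset_sum {F : Finset G} {w f : G}
    (hw : w ∈ F.powerset.image fun S => ∑ x ∈ S, x) (hf : f ∈ F) :
    w + f ∈ F.powerset.image fun S => ∑ x ∈ S, x := by
  obtain ⟨S, hS, rfl⟩ := Finset.mem_image.1 hw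
  rw [Finset.mem_powerset] at hS
  rw [Finset.mem_image]
  by_cases hfS : f ∈ S
  · refine ⟨S.erase f, Finset.mem_powerset.2 ((Finset.erase_subset _ _).trans hS), ?_⟩
    rw [← Finset.sum_erase_add _ _ hfS, add_assoc, ZModModule.add_self, add_zero]
  · refine ⟨insert f S, Finset.mem_powerset.2 (Finset.insert_subset hf hS), ?_⟩
    rw [Finset.sum_insert hfS, add_comm]

/-- A set of bounded doubling spans a subspace of comparable size. -/
lemma two_pow_card_le_of_linearIndepOn {X E : Finset G} {K : ℕ} (hX : (0 : G) ∈ X) (hEX : E ⊆ X)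
    (hE : LinearIndepOn (ZMod 2) id (E : Set G)) (hK : (X + X).card ≤ K * X.card) :
    2 ^ E.card ≤ 2 ^ K ^ 4 * (K * X.card) := by
  have hne : X.Nonempty := ⟨0, hX⟩
  have h4 : ((4 • X).card : ℝ) ≤ (K ^ 4 : ℕ) * X.card := by
    have h1 := Finset.pluennecke_ruzsa_inequality_nsmul_add hne X 4
    have h2 : ((X + X).card : ℚ≥0) / X.card ≤ K := by
      rw [div_le_iff₀ (by exact_mod_cast hne.card_pos)]
      exact_mod_cast hK
    have h3 : ((4 • X).card : ℚ≥0) ≤ (K : ℚ≥0) ^ 4 * X.card := h1.trans (by gcongr)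
    exact_mod_cast h3
  have h4' : ((3 • X + X).card : ℝ) ≤ (K ^ 4 : ℕ) * X.card := by
    rwa [← succ_nsmul]
  obtain ⟨F, _, hFc, hcov⟩ := Finset.ruzsa_covering_add hne h4'
  have hFc : F.card ≤ K ^ 4 := by exact_mod_cast hFc
  set W := F.powerset.image fun S => ∑ x ∈ S, x with hW
  -- By covering, 3X ⊆ F + (X - X), and W absorbs F in characteristic 2. Hence W + 2X is closed
  -- under adding X and contains all subset sums of E.
  have hcl : ∀ u ∈ W + (X + X), ∀ x ∈ X, u + x ∈ W + (X + X) := by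
    intro u hu x hx
    obtain ⟨w, hw, y, hy, rfl⟩ := Finset.mem_add.1 hu
    have h1 : y + x ∈ 3 • X := by
      rw [succ_nsmul, two_nsmul]
      exact Finset.add_mem_add hy hx
    obtain ⟨f, hf, z, hz, hfz⟩ := Finset.mem_add.1 (hcov h1)
    obtain ⟨a, ha, b, hb, rfl⟩ := Finset.mem_sub.1 hz
    have e : w + y + x = w + f + (a + b) := by
      rw [add_assoc, ← hfz, ZModModule.sub_eq_add, add_assoc]
    rw [e]
    exact Finset.add_mem_add (sum_add_mem_image_powerset_sum hw hf) (Finset.add_mem_add ha hb)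
  have hmem : ∀ T ⊆ E, ∑ x ∈ T, x ∈ W + (X + X) := by
    intro T
    induction T using Finset.induction_on with
    | empty =>
      intro _
      rw [Finset.sum_empty]
      refine Finset.mem_add.2 ⟨0, ?_, 0, ?_, add_zero 0⟩
      · exact Finset.mem_image.2 ⟨∅, by simp, by simp⟩
      · exact Finset.mem_add.2 ⟨0, hX, 0, hX, add_zero 0⟩
    | insert a T ha ih =>
      intro h
      rw [Finset.sum_insert ha, add_comm a]
      exact hcl _ (ih fun x hx => h (Finset.mem_insert_of_mem hx)) _
        (hEX (h (Finset.mem_insert_self a T)))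
  calc 2 ^ E.card = E.powerset.card := (Finset.card_powerset E).symm
    _ ≤ (W + (X + X)).card := by
        refine Finset.card_le_card_of_injOn (fun S => ∑ x ∈ S, x) ?_ ?_
        · intro T hT
          exact hmem T (by simpa using hT)
        · intro T hT T' hT' h
          exact sum_injOn_of_linearIndepOn hE (by simpa using hT) (by simpa using hT') h
    _ ≤ W.card * (X + X).card := Finset.card_add_le
    _ ≤ 2 ^ K ^ 4 * (K * X.card) := by
        refine Nat.mul_le_mul ?_ hK
        refine Finset.card_image_le.trans ?_
        rw [Finset.card_powerset]
        exact Nat.pow_le_pow_right (by norm_num) hFc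

/-- The pairs {x, x + z} with x in T are disjoint, so a random colouring makes none of them
monochromatic in colour c with probability at most (1 - 1/D²)^|T|. In the induction, overwriting the
colours of a and a + z by c is at most D²-to-one. -/
lemma card_colouring_avoiding_le {D : ℕ} {z : G} (hz : z ≠ 0) (c : Fin D) (T : Finset G)
    (hT : ∀ x ∈ T, x + z ∉ T) :
    (Finset.univ.filter fun f : G → Fin D => ∀ x ∈ T, ¬ (f x = c ∧ f (x + z) = c)).card *
      (D ^ 2) ^ T.card ≤ (D ^ 2 - 1) ^ T.card * D ^ Fintype.card G := by
  classical
  induction T using Finset.induction_on with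
  | empty => simp
  | insert a T ha ih =>
    have ih := ih fun x hx h => hT x (Finset.mem_insert_of_mem hx) (Finset.mem_insert_of_mem h)
    set A := Finset.univ.filter fun f : G → Fin D => ∀ x ∈ T, ¬ (f x = c ∧ f (x + z) = c) with hA
    have haz : a + z ∉ insert a T := hT a (Finset.mem_insert_self a T)
    have hne : a + z ≠ a := by simpa using hz
    have hA' : (Finset.univ.filter fun f : G → Fin D =>
        ∀ x ∈ insert a T, ¬ (f x = c ∧ f (x + z) = c)) =
        A.filter fun f => ¬ (f a = c ∧ f (a + z) = c) := by
      ext f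
      simp only [hA, Finset.mem_filter, Finset.mem_univ, true_and, Finset.forall_mem_insert]
      tauto
    rw [hA', Finset.card_insert_of_notMem ha]
    have hsplit := Finset.card_filter_add_card_filter_not (s := A)
      (fun f => f a = c ∧ f (a + z) = c)
    set B := A.filter fun f => f a = c ∧ f (a + z) = c with hB
    have hAB : A.card ≤ D ^ 2 * B.card := by
      have : A.card ≤ (Finset.univ ×ˢ B : Finset ((Fin D × Fin D) × (G → Fin D))).card := by
        refine Finset.card_le_card_of_injOn (fun f => ((f a, f (a + z)),
          Function.update (Function.update f a c) (a + z) c)) ?_ ?_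
        · intro f hf
          simp only [hA, Finset.coe_filter, Finset.mem_univ, true_and, Set.mem_ofPred_eq] at hf
          simp only [Finset.coe_product, Finset.coe_univ, Set.mem_prod, Set.mem_univ, true_and,
            hB, hA, Finset.mem_coe, Finset.mem_filter, Finset.mem_univ]
          refine ⟨fun x hx => ?_, ?_, ?_⟩
          · have e1 : x ≠ a := fun h => ha (h ▸ hx)
            have e2 : x ≠ a + z := fun h => haz (Finset.mem_insert_of_mem (h ▸ hx))
            have e3 : x + z ≠ a := fun h => by
              apply haz
              rw [← h, add_assoc, ZModModule.add_self, add_zero]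
              exact Finset.mem_insert_of_mem hx
            have e4 : x + z ≠ a + z := fun h => e1 (add_right_cancel h)
            rw [Function.update_of_ne e2, Function.update_of_ne e1, Function.update_of_ne e4,
              Function.update_of_ne e3]
            exact hf x hx
          · rw [Function.update_of_ne hne.symm, Function.update_self]
          · rw [Function.update_self]
        · intro f _ g _ h
          simp only [Prod.mk.injEq] at h
          obtain ⟨⟨h1, h2⟩, h3⟩ := h
          funext x
          by_cases e1 : x = a + z
          · rw [e1, h2]
          by_cases e2 : x = a
          · rw [e2, h1]
          have := congrFun h3 x
          rwa [Function.update_of_ne e1, Function.update_of_ne e2, Function.update_of_ne e1,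
            Function.update_of_ne e2] at this
      rwa [Finset.card_product, Finset.card_univ, Fintype.card_prod, Fintype.card_fin,
        ← pow_two] at this
    set C := A.filter fun f => ¬ (f a = c ∧ f (a + z) = c) with hC
    have hstep : C.card * D ^ 2 ≤ (D ^ 2 - 1) * A.card := by
      rw [Nat.sub_mul, one_mul, ← hsplit, mul_add, mul_comm _ (D ^ 2)]
      rw [← hsplit] at hAB
      omega
    calc C.card * (D ^ 2) ^ (T.card + 1) = (C.card * D ^ 2) * (D ^ 2) ^ T.card := by
          rw [pow_succ]; ring
      _ ≤ (D ^ 2 - 1) * A.card * (D ^ 2) ^ T.card := Nat.mul_le_mul_right _ hstep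
      _ = (D ^ 2 - 1) * (A.card * (D ^ 2) ^ T.card) := by ring
      _ ≤ (D ^ 2 - 1) * ((D ^ 2 - 1) ^ T.card * D ^ Fintype.card G) := Nat.mul_le_mul_left _ ih
      _ = (D ^ 2 - 1) ^ (T.card + 1) * D ^ Fintype.card G := by rw [pow_succ]; ring

/-- The number of representations of `z` as a sum of two elements of `X`. -/
def repCount (X : Finset G) (z : G) : ℕ := (X.filter fun x => x + z ∈ X).card

/-- A functional φ with φ z = 1 separates x from x + z, so the half where φ vanishes takes one
element from each pair {x, x + z}. -/
lemma exists_transversal (X : Finset G) {z : G} (hz : z ≠ 0) {w : ℕ} (hw : 2 * w ≤ repCount X z) :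
    ∃ T ⊆ X, T.card = w ∧ (∀ x ∈ T, x + z ∈ X) ∧ ∀ x ∈ T, x + z ∉ T := by
  obtain ⟨φ, hφ⟩ : ∃ φ : Module.Dual (ZMod 2) G, φ z ≠ 0 := by
    by_contra h
    push Not at h
    exact hz ((Module.forall_dual_apply_eq_zero_iff (ZMod 2) z).1 h)
  have hφ1 : φ z = 1 := by
    generalize φ z = a at hφ
    revert hφ
    revert a
    decide
  set N := X.filter fun x => x + z ∈ X with hN
  have h1 := Finset.card_filter_add_card_filter_not (s := N) (fun x => φ x = 0)
  have h2 : (N.filter fun x => ¬ φ x = 0).card ≤ (N.filter fun x => φ x = 0).card := by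
    refine Finset.card_le_card_of_injOn (fun x => x + z) ?_ fun x _ y _ h => add_right_cancel h
    intro x hx
    simp only [hN, Finset.coe_filter, Finset.mem_filter, Set.mem_ofPred_eq] at hx ⊢
    refine ⟨⟨hx.1.2, by rw [add_assoc, ZModModule.add_self, add_zero]; exact hx.1.1⟩, ?_⟩
    rw [map_add, hφ1]
    have := hx.2
    generalize φ x = a at this
    revert this
    revert a
    decide
  have h3 : w ≤ (N.filter fun x => φ x = 0).card := by
    rw [repCount, ← hN] at hw
    omega
  obtain ⟨T, hT, hTc⟩ := Finset.exists_subset_card_eq h3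
  have hT' : ∀ x ∈ T, x ∈ X ∧ x + z ∈ X ∧ φ x = 0 := fun x hx => by
    have := hT hx
    simp only [hN, Finset.mem_filter] at this
    exact ⟨this.1.1, this.1.2, this.2⟩
  refine ⟨T, fun x hx => (hT' x hx).1, hTc, fun x hx => (hT' x hx).2.1, fun x hx h => ?_⟩
  have h4 := (hT' _ h).2.2
  rw [map_add, (hT' x hx).2.2, hφ1] at h4
  exact absurd h4 (by decide)

/-- A sparse random subset of `X` has all popular sums among its sums. -/
lemma exists_subset_popular_subset_add {X P : Finset G} {D w : ℕ} (hD : 0 < D)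
    (hP : ∀ z ∈ P, z ≠ 0 ∧ 2 * w ≤ repCount X z)
    (hw : (P.card * D : ℝ) * Real.exp (-(w / D ^ 2)) < 1) :
    ∃ Y ⊆ X, Y.card * D ≤ X.card ∧ P ⊆ Y + Y := by
  classical
  -- A union bound over P and the D colours gives one colouring in which every colour class
  -- represents every z in P. Some class then has at most |X| / D elements.
  have hgood : ∃ f : G → Fin D, ∀ z ∈ P, ∀ c, ∃ x ∈ X, x + z ∈ X ∧ f x = c ∧ f (x + z) = c := by
    by_contra hcon
    push Not at hcon
    have hT : ∀ z ∈ P, ∃ T ⊆ X, T.card = w ∧ (∀ x ∈ T, x + z ∈ X) ∧ ∀ x ∈ T, x + z ∉ T :=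
      fun z hz => exists_transversal X (hP z hz).1 (hP z hz).2
    choose! T hTX hTc hTz hTd using hT
    have hcov : (Finset.univ : Finset (G → Fin D)) ⊆ (P ×ˢ Finset.univ).biUnion
        fun q : G × Fin D => Finset.univ.filter fun f : G → Fin D =>
          ∀ x ∈ T q.1, ¬ (f x = q.2 ∧ f (x + q.1) = q.2) := by
      intro f _
      obtain ⟨z, hz, c, h⟩ := hcon f
      rw [Finset.mem_biUnion]
      refine ⟨(z, c), by simp [hz], ?_⟩
      simp only [Finset.mem_filter, Finset.mem_univ, true_and]
      rintro x hx ⟨h1, h2⟩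
      exact h x (hTX z hz hx) (hTz z hz x hx) h1 h2
    have h1 := (Finset.card_le_card hcov).trans Finset.card_biUnion_le
    have h2 : (D ^ Fintype.card G) * (D ^ 2) ^ w ≤
        P.card * D * ((D ^ 2 - 1) ^ w * D ^ Fintype.card G) := by
      rw [Finset.card_univ, Fintype.card_fun, Fintype.card_fin] at h1
      refine (Nat.mul_le_mul_right _ h1).trans ?_
      rw [Finset.sum_mul]
      refine (Finset.sum_le_card_nsmul _ _ ((D ^ 2 - 1) ^ w * D ^ Fintype.card G) ?_).trans ?_
      · rintro ⟨z, c⟩ hq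
        simp only [Finset.mem_product, Finset.mem_univ, and_true] at hq
        have := card_colouring_avoiding_le (hP z hq).1 c (T z) (hTd z hq)
        rwa [hTc z hq] at this
      · rw [Finset.card_product, Finset.card_univ, Fintype.card_fin, smul_eq_mul]
    have h3 : (D ^ 2) ^ w ≤ P.card * D * (D ^ 2 - 1) ^ w := by
      refine Nat.le_of_mul_le_mul_left (c := D ^ Fintype.card G) ?_ (by positivity)
      refine h2.trans (le_of_eq (by ring))
    have hDR : (0 : ℝ) < D := by exact_mod_cast hD
    have h4 : ((D : ℝ) ^ 2) ^ w ≤ P.card * D * ((D : ℝ) ^ 2 - 1) ^ w := by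
      have h5 : ((D ^ 2 - 1 : ℕ) : ℝ) = (D : ℝ) ^ 2 - 1 := by
        rw [Nat.cast_sub (Nat.one_le_pow _ _ hD)]
        push_cast
        ring
      rw [← h5]
      exact_mod_cast h3
    have h6 : ((D : ℝ) ^ 2 - 1) ^ w ≤ ((D : ℝ) ^ 2) ^ w * Real.exp (-(w / D ^ 2)) := by
      have h7 : ((D : ℝ) ^ 2 - 1) = (D : ℝ) ^ 2 * (-(1 / D ^ 2) + 1) := by field_simp; ring
      have h8 : Real.exp (-(w / D ^ 2)) = Real.exp (-(1 / (D : ℝ) ^ 2)) ^ w := by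
        rw [← Real.exp_nat_mul]
        congr 1
        ring
      rw [h7, h8, mul_pow]
      refine mul_le_mul_of_nonneg_left (pow_le_pow_left₀ ?_ (Real.add_one_le_exp _) _)
        (by positivity)
      have : (1 : ℝ) / D ^ 2 ≤ 1 := by
        rw [div_le_one (by positivity)]
        have : (1 : ℝ) ≤ D := by exact_mod_cast hD
        nlinarith
      linarith
    have h9 : ((D : ℝ) ^ 2) ^ w * 1 ≤
        ((D : ℝ) ^ 2) ^ w * ((P.card * D : ℝ) * Real.exp (-(w / D ^ 2))) := by
      rw [mul_one]
      refine h4.trans ((mul_le_mul_of_nonneg_left h6 (by positivity)).trans (le_of_eq (by ring)))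
    have h10 := le_of_mul_le_mul_left h9 (by positivity)
    linarith
  obtain ⟨f, hf⟩ := hgood
  have : Nonempty (Fin D) := ⟨⟨0, hD⟩⟩
  obtain ⟨c, _, hc⟩ : ∃ c ∈ (Finset.univ : Finset (Fin D)),
      (X.filter fun x => f x = c).card * D ≤ X.card := by
    refine Finset.exists_le_of_sum_le (f := fun c => (X.filter fun x => f x = c).card * D)
      (g := fun _ => X.card) Finset.univ_nonempty ?_
    rw [← Finset.sum_mul, ← Finset.card_eq_sum_card_fiberwise fun _ _ => by simp]
    simp [mul_comm]
  refine ⟨X.filter fun x => f x = c, Finset.filter_subset _ _, hc, fun z hz => ?_⟩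
  obtain ⟨x, hx, hxz, h1, h2⟩ := hf z hz c
  refine Finset.mem_add.2 ⟨x, by simp [hx, h1], x + z, by simp [hxz, h2], ?_⟩
  rw [← add_assoc, ZModModule.add_self, zero_add]

end SmallDoubling

/-! ### Popular sums and cosets. -/

section Structure

open scoped Pointwise

variable {G : Type*} [AddCommGroup G] [Fintype G] [DecidableEq G] [Module (ZMod 2) G]

set_option linter.unusedSectionVars false

/-- The sums with at least `τ` representations. -/
def popularSums (X : Finset G) (τ : ℕ) : Finset G := (X + X).filter fun z => τ ≤ repCount X z

/-- If there are few popular sums, then they contain all sums of elements of a large subset. -/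
lemma exists_subset_add_subset_popularSums {X : Finset G} {τ b : ℕ}
    (hb : (popularSums X τ).card + τ + 2 * b ≤ 2 * X.card) :
    ∃ X' ⊆ X, (X \ X').card * b ≤ (X + X).card * τ ∧ X' + X' ⊆ popularSums X τ := by
  classical
  set P := popularSums X τ with hP
  -- The elements with at most b unpopular sums. Fewer than τ pairs share each unpopular sum, so at
  -- most |X + X| τ pairs are bad, which bounds the elements discarded.
  set X' := X.filter fun x => (X.filter fun y => x + y ∉ P).card ≤ b with hX'
  refine ⟨X', Finset.filter_subset _ _, ?_, ?_⟩
  · have h1 : (X \ X').card * b ≤ ∑ x ∈ X, (X.filter fun y => x + y ∉ P).card := by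
      rw [← smul_eq_mul, ← Finset.sum_const]
      refine (Finset.sum_le_sum fun x hx => ?_).trans
        (Finset.sum_le_sum_of_subset (Finset.sdiff_subset (s := X) (t := X')))
      simp only [hX', Finset.mem_sdiff, Finset.mem_filter, not_and, not_le] at hx
      exact (hx.2 hx.1).le
    refine h1.trans ?_
    have h2 : ∑ x ∈ X, (X.filter fun y => x + y ∉ P).card =
        ((X ×ˢ X).filter fun q => q.1 + q.2 ∉ P).card := by
      simp_rw [Finset.card_filter]
      rw [Finset.sum_product]
    rw [h2]
    refine (Finset.card_le_mul_card_image_of_maps_to (f := fun q : G × G => q.1 + q.2)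
      (t := X + X) ?_ τ ?_).trans (le_of_eq (mul_comm _ _))
    · intro q hq
      simp only [Finset.mem_filter, Finset.mem_product] at hq
      exact Finset.add_mem_add hq.1.1 hq.1.2
    · intro z hz
      by_cases hzP : z ∈ P
      · rw [Finset.card_eq_zero.2]
        · exact Nat.zero_le _
        · refine Finset.filter_eq_empty_iff.2 fun q hq h => ?_
          exact (Finset.mem_filter.1 hq).2 (h ▸ hzP)
      · have h3 : repCount X z < τ := by
          by_contra h
          exact hzP (by simp only [hP, popularSums, Finset.mem_filter]; exact ⟨hz, not_lt.1 h⟩)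
        refine le_trans (Finset.card_le_card_of_injOn (fun q => q.1) ?_ ?_) h3.le
        · intro q hq
          simp only [Finset.coe_filter, Finset.mem_filter, Finset.mem_product,
            Set.mem_ofPred_eq] at hq ⊢
          refine ⟨hq.1.1.1, ?_⟩
          rw [← hq.2, ← add_assoc, ZModModule.add_self, zero_add]
          exact hq.1.1.2
        · intro q hq q' hq' h
          simp only [Finset.coe_filter, Finset.mem_filter, Finset.mem_product,
            Set.mem_ofPred_eq] at hq hq'
          have h' : q.1 = q'.1 := h
          have h4 := hq.2.trans hq'.2.symm
          rw [h'] at h4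
          exact Prod.ext h' (add_left_cancel h4)
  · intro z hz
    obtain ⟨x, hx, y, hy, rfl⟩ := Finset.mem_add.1 hz
    simp only [hX', Finset.mem_filter] at hx hy
    -- Both A and B lie in P and have at least |X| - b elements, so they meet in at least τ points.
    -- Each common point x + a = y + c represents x + y as a + c.
    set A := (X.filter fun u => x + u ∈ P).image (x + ·) with hA
    set B := (X.filter fun u => y + u ∈ P).image (y + ·) with hB
    have hAc : X.card ≤ A.card + b := by
      rw [hA, Finset.card_image_of_injective _ (add_right_injective x)]
      have := Finset.card_filter_add_card_filter_not (s := X) (fun u => x + u ∈ P)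
      omega
    have hBc : X.card ≤ B.card + b := by
      rw [hB, Finset.card_image_of_injective _ (add_right_injective y)]
      have := Finset.card_filter_add_card_filter_not (s := X) (fun u => y + u ∈ P)
      omega
    have hABP : (A ∪ B).card ≤ P.card := by
      refine Finset.card_le_card (Finset.union_subset ?_ ?_) <;> intro u hu <;>
        obtain ⟨v, hv, rfl⟩ := Finset.mem_image.1 hu <;> exact (Finset.mem_filter.1 hv).2
    have hint := Finset.card_union_add_card_inter A B
    simp only [hP, popularSums, Finset.mem_filter]
    refine ⟨Finset.add_mem_add hx.1 hy.1, ?_⟩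
    refine le_trans (show τ ≤ (A ∩ B).card by omega)
      (Finset.card_le_card_of_injOn (fun u => u + x) ?_ fun u _ v _ h => add_right_cancel h)
    intro u hu
    simp only [hA, hB, Finset.coe_inter, Finset.coe_image, Set.mem_inter_iff, Set.mem_image,
      Finset.coe_filter, Set.mem_ofPred_eq] at hu ⊢
    obtain ⟨⟨a, ha, rfl⟩, c, hc, hca⟩ := hu
    have e1 : x + a + x = a := by rw [add_comm x a, add_assoc, ZModModule.add_self, add_zero]
    have e2 : a + (x + y) = c := by
      have : a + (x + y) = (x + a) + y := by abel
      rw [this, ← hca, add_comm y c, add_assoc, ZModModule.add_self, add_zero]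
    simp only [e1]
    exact ⟨ha.1, e2 ▸ hc.1⟩

lemma exists_representatives (H : AddSubgroup G) (A : Finset G) :
    ∃ ρ ⊆ A, ρ + subgroupFinset H = A + subgroupFinset H ∧
      ρ.card * (subgroupFinset H).card = (A + subgroupFinset H).card := by
  classical
  obtain ⟨ρ, hρA, hinj, himg⟩ : ∃ ρ ⊆ A, Set.InjOn (fun x : G => (x : G ⧸ H)) (ρ : Set G) ∧
      ∀ a ∈ A, ∃ x ∈ ρ, (x : G ⧸ H) = a := by
    have : ∀ q ∈ A.image (fun x : G => (x : G ⧸ H)), ∃ x ∈ A, (x : G ⧸ H) = q := fun q hq =>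
      Finset.mem_image.1 hq
    choose! f hfA hf using this
    refine ⟨(A.image (fun x : G => (x : G ⧸ H))).image f, ?_, ?_, ?_⟩
    · intro x hx
      obtain ⟨q, hq, rfl⟩ := Finset.mem_image.1 hx
      exact hfA q hq
    · intro x hx y hy h
      obtain ⟨q, hq, rfl⟩ := Finset.mem_image.1 (Finset.mem_coe.1 hx)
      obtain ⟨q', hq', rfl⟩ := Finset.mem_image.1 (Finset.mem_coe.1 hy)
      have h' : (f q : G ⧸ H) = f q' := h
      rw [hf q hq, hf q' hq'] at h'
      rw [h']
    · intro a ha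
      have hq := Finset.mem_image_of_mem (fun x : G => (x : G ⧸ H)) ha
      exact ⟨f a, Finset.mem_image_of_mem f hq, hf _ hq⟩
  have heq : ρ + subgroupFinset H = A + subgroupFinset H := by
    refine Finset.Subset.antisymm (Finset.add_subset_add_right hρA) fun z hz => ?_
    obtain ⟨a, ha, h, hh, rfl⟩ := Finset.mem_add.1 hz
    obtain ⟨x, hx, hxa⟩ := himg a ha
    rw [QuotientAddGroup.eq] at hxa
    rw [mem_subgroupFinset] at hh
    exact Finset.mem_add.2 ⟨x, hx, -x + a + h, by simpa using H.add_mem hxa hh, by abel⟩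
  refine ⟨ρ, hρA, heq, ?_⟩
  rw [← heq, ← Finset.card_product]
  refine Finset.card_bij (fun q _ => q.1 + q.2) ?_ ?_ ?_
  · intro q hq
    rw [Finset.mem_product] at hq
    exact Finset.add_mem_add hq.1 hq.2
  · intro q hq q' hq' h
    rw [Finset.mem_product, mem_subgroupFinset] at hq hq'
    have h1 : q.1 = q'.1 := by
      refine hinj hq.1 hq'.1 ?_
      change (q.1 : G ⧸ H) = q'.1
      rw [QuotientAddGroup.eq]
      have : -q.1 + q'.1 = q.2 - q'.2 := by
        have h' : q.1 + q.2 = q'.1 + q'.2 := h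
        rw [neg_add_eq_sub, sub_eq_sub_iff_add_eq_add, ← h', add_comm]
      rw [this]
      exact H.sub_mem hq.2 hq'.2
    have h' : q.1 + q.2 = q'.1 + q'.2 := h
    rw [h1] at h'
    exact Prod.ext h1 (add_left_cancel h')
  · intro z hz
    obtain ⟨a, ha, h, hh, rfl⟩ := Finset.mem_add.1 hz
    exact ⟨(a, h), by simp [ha, mem_subgroupFinset.1 hh], rfl⟩

/-- The set of all linear combinations of the `w i`. -/
def spanFinset {k : ℕ} (w : Fin k → G) : Finset G := Finset.univ.image fun c => linComb w c

lemma exists_spanFinset_eq {H : AddSubgroup G} {k : ℕ} (hk : (subgroupFinset H).card ≤ 2 ^ k) :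
    ∃ w : Fin k → G, (∀ i, w i ∈ H) ∧ spanFinset w = subgroupFinset H := by
  classical
  obtain ⟨E, hEH, hE, hsp⟩ := exists_finset_linearIndepOn_subset_span (subgroupFinset H)
  have hsum : ∀ T ⊆ E, ∑ x ∈ T, x ∈ subgroupFinset H := fun T hT => by
    rw [mem_subgroupFinset]
    exact H.sum_mem fun x hx => by simpa using hEH (hT hx)
  have hEk : E.card ≤ k := by
    have h1 : 2 ^ E.card ≤ (subgroupFinset H).card := by
      rw [← Finset.card_powerset]
      refine Finset.card_le_card_of_injOn (fun S => ∑ x ∈ S, x) ?_ ?_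
      · intro T hT
        exact hsum T (by simpa using hT)
      · intro T hT T' hT' h
        exact sum_injOn_of_linearIndepOn hE (by simpa using hT) (by simpa using hT') h
    exact (Nat.pow_le_pow_iff_right (by norm_num)).1 (h1.trans hk)
  have hmem : ∀ x ∈ Submodule.span (ZMod 2) (E : Set G), x ∈ H := by
    intro x hx
    have h1 : Submodule.span (ZMod 2) (E : Set G) ≤
        AddSubgroup.toZModSubmodule 2 H := by
      rw [Submodule.span_le]
      intro y hy
      simpa using hEH hy
    simpa using h1 hx
  obtain ⟨v, hv⟩ : ∃ v : Fin k → G, (∀ i, v i ∈ H) ∧ (E : Set G) ⊆ Set.range v := by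
    rcases E.eq_empty_or_nonempty with rfl | hne
    · exact ⟨0, by simp [H.zero_mem], by simp⟩
    · obtain ⟨v, hv⟩ := Finset.exists_fin_image_eq hne hEk
      refine ⟨v, fun i => ?_, fun x hx => ?_⟩
      · have : v i ∈ E := hv ▸ Finset.mem_image_of_mem v (Finset.mem_univ i)
        simpa using hEH this
      · rw [← hv] at hx
        simpa using hx
  refine ⟨v, hv.1, ?_⟩
  ext x
  rw [spanFinset, Finset.mem_image]
  constructor
  · rintro ⟨c, _, rfl⟩
    rw [mem_subgroupFinset, linComb]
    refine H.sum_mem fun i _ => ?_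
    have := (AddSubgroup.toZModSubmodule 2 H).smul_mem (c i)
      (show v i ∈ AddSubgroup.toZModSubmodule 2 H by simpa using hv.1 i)
    simpa using this
  · intro hx
    obtain ⟨c, hc⟩ := (Submodule.mem_span_range_iff_exists_fun (ZMod 2)).1
      (Submodule.span_mono hv.2 (hsp hx))
    exact ⟨c, Finset.mem_univ _, hc⟩

end Structure

/-! ### The two families of certificates for small doubling. -/

section Families

open scoped Pointwise

variable {G : Type*} [AddCommGroup G] [Fintype G] [DecidableEq G] [Module (ZMod 2) G]

set_option linter.unusedSectionVars false

variable (G) in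
open Classical in
/-- The sumsets of small sets of small rank. -/
noncomputable def sampleFamily (R t g : ℕ) : Finset (Finset G) :=
  Finset.univ.filter fun S => g ≤ S.card ∧
    ∃ (v : Fin R → G) (y : Fin t → Fin R → ZMod 2),
      S = insert 0 (linCombImage v y + linCombImage v y)

lemma card_sampleFamily_le {n R t g : ℕ} (hn : Fintype.card G = 2 ^ n) :
    (sampleFamily G R t g).card ≤ 2 ^ (n * R + R * t) := by
  classical
  rw [← card_coordinates R t n hn, ← Finset.card_univ]
  refine (Finset.card_le_card (t := Finset.univ.image
    fun p : (Fin R → G) × (Fin t → Fin R → ZMod 2) =>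
      insert 0 (linCombImage p.1 p.2 + linCombImage p.1 p.2)) fun S hS => ?_).trans
    Finset.card_image_le
  simp only [sampleFamily, Finset.mem_filter, Finset.mem_univ, true_and] at hS
  obtain ⟨_, v, y, rfl⟩ := hS
  exact Finset.mem_image.2 ⟨(v, y), Finset.mem_univ _, rfl⟩

/-- A union of cosets given by coordinates of generators and representatives. -/
def cosetUnion {R k q : ℕ} (v : Fin R → G) (w : Fin k → Fin R → ZMod 2)
    (ρ : Fin q → Fin R → ZMod 2) : Finset G :=
  linCombImage v ρ + spanFinset fun i => linComb v (w i)

variable (G) in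
open Classical in
/-- The sets of sums of an almost periodic set and a further element. -/
noncomputable def periodicFamily (R k q e g : ℕ) : Finset (Finset G) :=
  Finset.univ.filter fun S => g ≤ S.card ∧
    ∃ (v : Fin R → G) (w : Fin k → Fin R → ZMod 2) (ρ : Fin q → Fin R → ZMod 2)
      (x : Fin R → ZMod 2) (X : Finset G),
      (cosetUnion v w ρ).card = 2 ^ k ∧ X ⊆ cosetUnion v w ρ ∧ X.card + e = 2 ^ k ∧
        S = (X + X) ∪ X.image (linComb v x + ·)

lemma card_periodicFamily_le {n R k q e g : ℕ} (hn : Fintype.card G = 2 ^ n) :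
    (periodicFamily G R k q e g).card ≤
      2 ^ (n * R + R * (k + q + 1)) * (2 ^ k).choose e := by
  classical
  let D := (Fin R → G) × (Fin k → Fin R → ZMod 2) × (Fin q → Fin R → ZMod 2) × (Fin R → ZMod 2)
  let P : D → Finset (Finset G) := fun p =>
    if (cosetUnion p.1 p.2.1 p.2.2.1).card = 2 ^ k ∧ e ≤ 2 ^ k then
      ((cosetUnion p.1 p.2.1 p.2.2.1).powersetCard (2 ^ k - e)).image
        fun X => (X + X) ∪ X.image (linComb p.1 p.2.2.2 + ·) else ∅
  have h1 : periodicFamily G R k q e g ⊆ Finset.univ.biUnion P := by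
    intro S hS
    simp only [periodicFamily, Finset.mem_filter, Finset.mem_univ, true_and] at hS
    obtain ⟨_, v, w, ρ, x, X, hc, hX, hXc, rfl⟩ := hS
    rw [Finset.mem_biUnion]
    refine ⟨(v, w, ρ, x), Finset.mem_univ _, ?_⟩
    simp only [P]
    rw [if_pos ⟨hc, by omega⟩]
    exact Finset.mem_image.2 ⟨X, Finset.mem_powersetCard.2 ⟨hX, by omega⟩, rfl⟩
  have hD : Fintype.card D = 2 ^ (n * R + R * (k + q + 1)) := by
    simp only [D, Fintype.card_prod, Fintype.card_fun, hn, Fintype.card_fin, ZMod.card]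
    rw [← pow_mul, ← pow_mul, ← pow_mul, ← pow_add, ← pow_add, ← pow_add]
    congr 1
    ring
  refine (Finset.card_le_card h1).trans ((Finset.card_biUnion_le_card_mul _ _ ((2 ^ k).choose e)
    fun p _ => ?_).trans (le_of_eq ?_))
  · simp only [P]
    split_ifs with hN
    · refine Finset.card_image_le.trans ?_
      rw [Finset.card_powersetCard, hN.1, Nat.choose_symm hN.2]
    · simp
  · rw [Finset.card_univ, hD]

/-- A set of bounded doubling with more than `2 ^ k` elements has among its sums a member of one of
two small families of large sets. -/
theorem exists_mem_family_subset_add {X E : Finset G} {k K R D t w g b d e q : ℕ}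
    (hXc : X.card = 2 ^ k + 1) (hK : (X + X).card ≤ K * X.card)
    (hE : E.card ≤ R) (hXE : (X : Set G) ⊆ Submodule.span (ZMod 2) (E : Set G)) (hD : 0 < D)
    (hexp : ((K * X.card : ℕ) * D : ℝ) * Real.exp (-(w / D ^ 2)) < 1) (ht : X.card ≤ t * D)
    (hg : 2 ≤ g) (hgb : g + 2 * w + 2 * b ≤ 2 * X.card) (heb : K * X.card * (2 * w) ≤ e * b)
    (hb : 0 < b) (hgd : g + d ≤ 2 ^ (k + 1)) (hed : 3 * e < d) (hq : 2 ^ k ≤ q * (d - 2 * e))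
    (he : e < 2 ^ k) :
    (∃ S ∈ sampleFamily G R t g, S ⊆ X + X) ∨
      ∃ S ∈ periodicFamily G R k q e (2 ^ (k + 1) - e), S ⊆ X + X := by
  classical
  obtain ⟨v, hv⟩ := exists_linComb_eq hE
  have hvX : ∀ x ∈ X, ∃ c, linComb v c = x := fun x hx => hv x (hXE hx)
  have hXne : X.Nonempty := Finset.card_pos.1 (by omega)
  have h0 : (0 : G) ∈ X + X := by
    obtain ⟨x, hx⟩ := hXne
    exact Finset.mem_add.2 ⟨x, hx, x, hx, ZModModule.add_self x⟩
  -- Few popular sums force periodic structure; many popular sums can be sampled.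
  rcases Nat.lt_or_ge (popularSums X (2 * w)).card g with hP | hP
  · right
    obtain ⟨X₁, hX₁, hc₁, hX₁P⟩ := exists_subset_add_subset_popularSums (X := X) (τ := 2 * w)
      (b := b) (by omega)
    have h1 : (X \ X₁).card ≤ e :=
      Nat.le_of_mul_le_mul_right (hc₁.trans ((Nat.mul_le_mul_right _ hK).trans heb)) hb
    have h2 : (X \ X₁).card + X₁.card = X.card := Finset.card_sdiff_add_card_eq_card hX₁
    -- Trimming to exactly 2^k - e elements leaves a complement of size exactly e in the union of
    -- cosets, so `(2 ^ k).choose e` counts the choices.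
    obtain ⟨X₂, hX₂, hc₂⟩ := Finset.exists_subset_card_eq (show 2 ^ k - e ≤ X₁.card by omega)
    have hX₂X : X₂ ⊆ X := hX₂.trans hX₁
    have hX₂ne : X₂.Nonempty := Finset.card_pos.1 (by omega)
    have hX₂P : (X₂ + X₂).card < g :=
      (Finset.card_le_card ((Finset.add_subset_add hX₂ hX₂).trans hX₁P)).trans_lt hP
    obtain ⟨H, hHs, hHd, hZ, hx⟩ := exists_subgroup_of_card_add_self_add_le (k := k) (d := d) (e := e)
      hX₂ne (by omega) (by omega) hed
    obtain ⟨x, hxX, hxZ⟩ : ∃ x ∈ X, x ∉ X₂ + subgroupFinset H := by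
      by_contra h
      push Not at h
      have := Finset.card_le_card (show X ⊆ X₂ + subgroupFinset H from h)
      omega
    -- Since 0 = u + u is a sum, H ⊆ X₂ + X₂. Hence H lies in the span of X and its generators cost
    -- only R bits each.
    have hHX : ∀ h ∈ H, ∃ c, linComb v c = h := by
      intro h hh
      obtain ⟨u, hu⟩ := hX₂ne
      have h3 := mem_translateStab.1 (hHs hh) _ (Finset.add_mem_add hu hu)
      rw [ZModModule.add_self, add_zero] at h3
      obtain ⟨a, ha, c, hc, rfl⟩ := Finset.mem_add.1 h3
      exact hv _ (Submodule.add_mem _ (hXE (hX₂X ha)) (hXE (hX₂X hc)))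
    have hHk : (subgroupFinset H).card ≤ 2 ^ k := by
      rw [← hZ]
      exact card_subgroupFinset_le_of_le_translateStab (hX₂ne.add ⟨0, by simp⟩)
        (le_translateStab_add_subgroupFinset H X₂)
    obtain ⟨w', hw'H, hw'⟩ := exists_spanFinset_eq hHk
    choose W hW using fun i => hHX (w' i) (hw'H i)
    obtain ⟨ρ, hρX, hρ, hρc⟩ := exists_representatives H X₂
    have hρq : ρ.card ≤ q := by
      have h3 : ρ.card * (d - 2 * e) ≤ q * (d - 2 * e) := by
        refine le_trans ?_ hq
        rw [← hZ, ← hρc]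
        exact Nat.mul_le_mul_left _ (by omega)
      exact Nat.le_of_mul_le_mul_right h3 (by omega)
    have hρne : ρ.Nonempty := by
      rw [Finset.nonempty_iff_ne_empty]
      rintro rfl
      rw [Finset.card_empty, zero_mul, hZ] at hρc
      have : 0 < 2 ^ k := by positivity
      omega
    obtain ⟨y, hy⟩ := exists_linCombImage_eq (fun x hx => hvX x (hX₂X (hρX hx))) hρne hρq
    obtain ⟨c, hc⟩ := hvX x hxX
    have hZeq : cosetUnion v W y = X₂ + subgroupFinset H := by
      rw [cosetUnion, hy, ← hρ, ← hw']
      congr 2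
      exact funext hW
    refine ⟨(X₂ + X₂) ∪ X₂.image (x + ·), ?_, ?_⟩
    · simp only [periodicFamily, Finset.mem_filter, Finset.mem_univ, true_and]
      refine ⟨?_, v, W, y, c, X₂, ?_, ?_, ?_, ?_⟩
      · have := hx x hxZ
        omega
      · rw [hZeq, hZ]
      · rw [hZeq]
        exact subset_add_subgroupFinset H X₂
      · omega
      · rw [hc]
    · refine Finset.union_subset (Finset.add_subset_add hX₂X hX₂X) fun z hz => ?_
      obtain ⟨u, hu, rfl⟩ := Finset.mem_image.1 hz
      exact Finset.add_mem_add hxX (hX₂X hu)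
  · left
    -- Sampling needs z ≠ 0; inserting 0 by hand afterwards keeps the count at least g.
    set P := (popularSums X (2 * w)).erase 0 with hPdef
    have hPs : popularSums X (2 * w) ⊆ X + X := Finset.filter_subset _ _
    obtain ⟨Y, hYX, hYD, hPY⟩ := exists_subset_popular_subset_add (X := X) (P := P) (D := D)
      (w := w) hD (fun z hz => by
        simp only [hPdef, Finset.mem_erase, popularSums, Finset.mem_filter] at hz
        exact ⟨hz.1, hz.2.2⟩) (by
        refine lt_of_le_of_lt ?_ hexp
        have h1 : P.card ≤ K * X.card :=
          (Finset.card_le_card ((Finset.erase_subset _ _).trans hPs)).trans hK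
        gcongr)
    have hYt : Y.card ≤ t := Nat.le_of_mul_le_mul_right (hYD.trans ht) hD
    have hYne : Y.Nonempty := by
      rw [Finset.nonempty_iff_ne_empty]
      rintro rfl
      rw [Finset.add_empty, Finset.subset_empty] at hPY
      have h2 := Finset.pred_card_le_card_erase (s := popularSums X (2 * w)) (a := 0)
      rw [← hPdef, hPY, Finset.card_empty] at h2
      omega
    obtain ⟨y, hy⟩ := exists_linCombImage_eq (fun x hx => hvX x (hYX hx)) hYne hYt
    refine ⟨insert 0 (Y + Y), ?_, Finset.insert_subset h0 (Finset.add_subset_add hYX hYX)⟩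
    simp only [sampleFamily, Finset.mem_filter, Finset.mem_univ, true_and]
    refine ⟨hP.trans (Finset.card_le_card fun z hz => ?_), v, y, by rw [hy]⟩
    by_cases hz0 : z = 0
    · simp [hz0]
    · exact Finset.mem_insert_of_mem (hPY (Finset.mem_erase.2 ⟨hz0, hz⟩))

end Families

/-! ### Union bounds for the three cases. -/

section UpperBound

open scoped Pointwise

lemma card_filter_subset_eq {α : Type*} [Fintype α] [DecidableEq α] (T : Finset α) :
    ((Finset.univ.filter fun A : Finset α => T ⊆ A).card : ℝ) =
      2 ^ Fintype.card α * (1 / 2) ^ T.card := by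
  have h : (Finset.univ.filter fun A : Finset α => T ⊆ A) = Finset.Icc T Finset.univ := by
    ext A
    simp
  rw [h, Finset.card_Icc_finset (Finset.subset_univ T), Finset.card_univ]
  push_cast
  rw [pow_sub₀ _ two_ne_zero (Finset.card_le_univ T), one_div, inv_pow]

variable {G : Type*} [AddCommGroup G] [Fintype G] [DecidableEq G]

/-- The union bound over a family of large sets. -/
lemma card_filter_exists_erase_subset_le (𝒮 : Finset (Finset G)) {g : ℕ}
    (h : ∀ S ∈ 𝒮, g ≤ S.card) :
    ((Finset.univ.filter fun A : Finset G => ∃ S ∈ 𝒮, S.erase 0 ⊆ A).card : ℝ) ≤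
      2 ^ Fintype.card G * (𝒮.card * (2 * (1 / 2) ^ g)) := by
  have h1 : (Finset.univ.filter fun A : Finset G => ∃ S ∈ 𝒮, S.erase 0 ⊆ A) =
      𝒮.biUnion fun S => Finset.univ.filter fun A : Finset G => S.erase 0 ⊆ A := by
    ext A
    simp
  have h2 : ((Finset.univ.filter fun A : Finset G => ∃ S ∈ 𝒮, S.erase 0 ⊆ A).card : ℝ) ≤
      ∑ S ∈ 𝒮, ((Finset.univ.filter fun A : Finset G => S.erase 0 ⊆ A).card : ℝ) := by
    rw [h1]
    exact_mod_cast Finset.card_biUnion_le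
  refine h2.trans ?_
  rw [← mul_left_comm, ← nsmul_eq_mul]
  refine Finset.sum_le_card_nsmul _ _ _ fun S hS => ?_
  rw [card_filter_subset_eq]
  refine mul_le_mul_of_nonneg_left ?_ (by positivity)
  -- A need not contain 0, which costs at most one element and hence the factor 2.
  have h3 : g ≤ (S.erase 0).card + 1 := by
    have := Finset.pred_card_le_card_erase (s := S) (a := 0)
    have := h S hS
    omega
  calc ((1 : ℝ) / 2) ^ (S.erase 0).card = 2 * (1 / 2) ^ ((S.erase 0).card + 1) := by
        rw [pow_succ]; ring
    _ ≤ 2 * (1 / 2) ^ g := by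
        refine mul_le_mul_of_nonneg_left ?_ (by norm_num)
        exact pow_le_pow_of_le_one (by norm_num) (by norm_num) h3

lemma two_pow_mul_half_pow_le {a g k : ℕ} (h : a + 1 + k ≤ g) :
    (2 : ℝ) ^ a * (2 * (1 / 2) ^ g) ≤ (1 / 2) ^ k := by
  have h1 : ((1 : ℝ) / 2) ^ g ≤ (1 / 2) ^ (a + 1 + k) :=
    pow_le_pow_of_le_one (by norm_num) (by norm_num) h
  calc (2 : ℝ) ^ a * (2 * (1 / 2) ^ g) ≤ 2 ^ a * (2 * (1 / 2) ^ (a + 1 + k)) := by gcongr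
    _ = (2 * (1 / 2)) ^ a * (2 * (1 / 2)) * (1 / 2) ^ k := by rw [mul_pow, pow_add, pow_succ]; ring
    _ = (1 / 2) ^ k := by norm_num

variable [Module (ZMod 2) G]

/-- At most 2^(s/2) sumsets of size s, each contained in A with probability at most 2 · 2^(-s),
contribute at most 2 · 2^(-4m) since s ≥ 8m. This absorbs the at most m² ≤ 2^(2m) values of s. -/
lemma card_large_doubling_le {n k p : ℕ} (hn : Fintype.card G = 2 ^ n)
    (hp : 2 ^ 16 ≤ p) (hk : 2 ^ 15 ≤ k) (hnk : n * k ≤ 2 ^ (k + 1)) :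
    ((Finset.univ.filter fun A : Finset G => ∃ X : Finset G, X.card = 2 ^ k + 1 ∧
        2 ^ p * X.card ≤ (X + X).card ∧ (X + X).erase 0 ⊆ A).card : ℝ) ≤
      2 ^ Fintype.card G * (1 / 2) ^ k := by
  classical
  set m := 2 ^ k + 1 with hm
  let F : ℕ → Finset (Finset G) := fun s =>
    (Finset.univ.filter fun X : Finset G => X.card = m ∧ (X + X).card = s).image fun X => X + X
  have hF : ∀ s, ∀ S ∈ F s, s ≤ S.card := by
    intro s S hS
    obtain ⟨X, hX, rfl⟩ := Finset.mem_image.1 hS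
    exact (Finset.mem_filter.1 hX).2.2.ge
  have h8 : 8 ≤ 2 ^ p :=
    calc 8 = 2 ^ 3 := by norm_num
      _ ≤ 2 ^ p := Nat.pow_le_pow_right (by norm_num) (le_trans (by norm_num) hp)
  have hkm : k < m := by have := Nat.lt_two_pow_self (n := k); omega
  have hsub : (Finset.univ.filter fun A : Finset G => ∃ X : Finset G, X.card = m ∧
        2 ^ p * X.card ≤ (X + X).card ∧ (X + X).erase 0 ⊆ A) ⊆
      (Finset.Icc (2 ^ p * m) (m * m)).biUnion fun s =>
        Finset.univ.filter fun A : Finset G => ∃ S ∈ F s, S.erase 0 ⊆ A := by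
    intro A hA
    simp only [Finset.mem_filter, Finset.mem_univ, true_and] at hA
    obtain ⟨X, hX, hXs, hXA⟩ := hA
    rw [Finset.mem_biUnion]
    refine ⟨(X + X).card, ?_, ?_⟩
    · rw [Finset.mem_Icc]
      rw [hX] at hXs
      refine ⟨hXs, ?_⟩
      have := Finset.card_add_le (s := X) (t := X)
      rwa [hX] at this
    · simp only [Finset.mem_filter, Finset.mem_univ, true_and]
      exact ⟨X + X, Finset.mem_image.2 ⟨X, by simp [hX], rfl⟩, hXA⟩
  have hone : ∀ s ∈ Finset.Icc (2 ^ p * m) (m * m),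
      ((Finset.univ.filter fun A : Finset G => ∃ S ∈ F s, S.erase 0 ⊆ A).card : ℝ) ≤
        2 ^ Fintype.card G * (2 * (1 / 2) ^ (4 * m)) := by
    intro s hs
    have hs := (Finset.mem_Icc.1 hs).1
    refine (card_filter_exists_erase_subset_le (F s) (hF s)).trans ?_
    refine mul_le_mul_of_nonneg_left ?_ (by positivity)
    have h1 : ((F s).card : ℝ) ≤ 2 ^ ((s : ℝ) / 2) := by
      refine le_trans ?_ (card_filter_card_add_self_eq_le hn hp hk hnk hs)
      exact_mod_cast Finset.card_image_le
    have h4 : 8 * m ≤ s := (Nat.mul_le_mul_right _ h8).trans hs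
    have h5 : (8 * m : ℝ) ≤ s := by exact_mod_cast h4
    have e1 : ((1 : ℝ) / 2) ^ s = 2 ^ (-(s : ℝ)) := by
      rw [Real.rpow_neg (by norm_num), Real.rpow_natCast, one_div, inv_pow]
    have e2 : ((1 : ℝ) / 2) ^ (4 * m) = 2 ^ (-((4 * m : ℕ) : ℝ)) := by
      rw [Real.rpow_neg (by norm_num), Real.rpow_natCast, one_div, inv_pow]
    calc ((F s).card : ℝ) * (2 * (1 / 2) ^ s) ≤ 2 ^ ((s : ℝ) / 2) * (2 * (1 / 2) ^ s) := by gcongr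
      _ = 2 * 2 ^ ((s : ℝ) / 2 + -(s : ℝ)) := by
          rw [Real.rpow_add (by norm_num), e1]; ring
      _ ≤ 2 * 2 ^ (-((4 * m : ℕ) : ℝ)) := by
          refine mul_le_mul_of_nonneg_left (Real.rpow_le_rpow_of_exponent_le (by norm_num) ?_)
            (by norm_num)
          push_cast
          linarith
      _ = 2 * (1 / 2) ^ (4 * m) := by rw [e2]
  have hsum : ((Finset.univ.filter fun A : Finset G => ∃ X : Finset G, X.card = m ∧
        2 ^ p * X.card ≤ (X + X).card ∧ (X + X).erase 0 ⊆ A).card : ℝ) ≤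
      (Finset.Icc (2 ^ p * m) (m * m)).card •
        (2 ^ Fintype.card G * (2 * (1 / 2) ^ (4 * m)) : ℝ) := by
    refine le_trans ?_ (Finset.sum_le_card_nsmul _ _ _ hone)
    exact_mod_cast (Finset.card_le_card hsub).trans Finset.card_biUnion_le
  refine hsum.trans ?_
  have hcard : ((Finset.Icc (2 ^ p * m) (m * m)).card : ℝ) ≤ 2 ^ (2 * m) := by
    have h1 : (Finset.Icc (2 ^ p * m) (m * m)).card ≤ m * m := by
      rw [Nat.card_Icc]
      have : 0 < 2 ^ p * m := by positivity
      omega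
    have h2 : m * m ≤ 2 ^ (2 * m) := by
      rw [two_mul, pow_add]
      exact Nat.mul_le_mul Nat.lt_two_pow_self.le Nat.lt_two_pow_self.le
    exact_mod_cast h1.trans h2
  rw [nsmul_eq_mul, mul_left_comm]
  refine mul_le_mul_of_nonneg_left ?_ (by positivity)
  refine (mul_le_mul_of_nonneg_right hcard (by positivity)).trans
    (two_pow_mul_half_pow_le (by omega))

lemma card_sample_le {n k R t g : ℕ} (hn : Fintype.card G = 2 ^ n)
    (h : n * R + R * t + 1 + k ≤ g) :
    ((Finset.univ.filter fun A : Finset G =>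
        ∃ S ∈ sampleFamily G R t g, S.erase 0 ⊆ A).card : ℝ) ≤
      2 ^ Fintype.card G * (1 / 2) ^ k := by
  refine (card_filter_exists_erase_subset_le (g := g) _ fun S hS => ?_).trans
    (mul_le_mul_of_nonneg_left ?_ (by positivity))
  · simp only [sampleFamily, Finset.mem_filter] at hS
    exact hS.2.1
  · refine le_trans (mul_le_mul_of_nonneg_right ?_ (by positivity)) (two_pow_mul_half_pow_le h)
    exact_mod_cast card_sampleFamily_le hn

/-- The parameter a bounds the choice of the e missing elements by ae + 2^(k-a+1) bits. -/
lemma card_periodic_le {n k R q e a g : ℕ} (hn : Fintype.card G = 2 ^ n) (ha : a ≤ k)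
    (h : n * R + R * (k + q + 1) + (a * e + 2 ^ (k - a + 1)) + 1 + k ≤ g) :
    ((Finset.univ.filter fun A : Finset G =>
        ∃ S ∈ periodicFamily G R k q e g, S.erase 0 ⊆ A).card : ℝ) ≤
      2 ^ Fintype.card G * (1 / 2) ^ k := by
  refine (card_filter_exists_erase_subset_le (g := g) (periodicFamily G R k q e g) fun S hS => ?_).trans
    (mul_le_mul_of_nonneg_left ?_ (by positivity))
  · simp only [periodicFamily, Finset.mem_filter] at hS
    exact hS.2.1
  · refine le_trans (mul_le_mul_of_nonneg_right ?_ (by positivity)) (two_pow_mul_half_pow_le h)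
    have h1 : ((periodicFamily G R k q e g).card : ℝ) ≤
        2 ^ (n * R + R * (k + q + 1)) * ((2 ^ k).choose e : ℝ) := by
      exact_mod_cast card_periodicFamily_le hn
    refine h1.trans ?_
    rw [pow_add _ (n * R + R * (k + q + 1))]
    refine mul_le_mul_of_nonneg_left ?_ (by positivity)
    refine (choose_le_two_pow_mul_exp (2 ^ k) e a).trans ?_
    rw [pow_add]
    refine mul_le_mul_of_nonneg_left ?_ (by positivity)
    have h2 : (((2 ^ k : ℕ) : ℝ) / 2 ^ a) = 2 ^ (k - a) := by
      rw [pow_sub₀ _ two_ne_zero ha]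
      push_cast
      rfl
    rw [h2]
    refine (exp_le_two_rpow (by positivity)).trans (le_of_eq ?_)
    have h3 : ((2 ^ (k - a + 1) : ℕ) : ℝ) = 2 * 2 ^ (k - a) := by
      push_cast
      ring
    rw [← Real.rpow_natCast 2 (2 ^ (k - a + 1)), h3]

end UpperBound

/-! ### Choice of parameters and the upper bound on the clique number. -/

section UpperBoundConclusion

open scoped Pointwise

/-- With D = k² and w ≥ k^6 the exponent w / D² is at least k², which beats the 2^(O(k)) events of
the sampling step. -/
lemma sampling_exp_lt_one {k p w : ℕ} (hk : p + 5 ≤ k) (hw : k ^ 6 ≤ w) :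
    ((2 ^ p * (2 ^ k + 1) : ℕ) * (k ^ 2 : ℕ) : ℝ) * Real.exp (-(w / (k ^ 2 : ℕ) ^ 2)) < 1 := by
  have hk0 : 0 < k := by omega
  have h1 : ((k ^ 2 : ℕ) : ℝ) ≤ w / (k ^ 2 : ℕ) ^ 2 := by
    rw [le_div_iff₀ (by positivity)]
    calc ((k ^ 2 : ℕ) : ℝ) * (k ^ 2 : ℕ) ^ 2 = (k ^ 6 : ℕ) := by push_cast; ring
      _ ≤ w := by exact_mod_cast hw
  have h2 : Real.exp (-(w / (k ^ 2 : ℕ) ^ 2)) ≤ (1 / 2) ^ (k ^ 2) := by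
    have h3 : Real.exp (-1) ≤ 1 / 2 := by
      rw [Real.exp_neg, one_div]
      exact inv_anti₀ (by norm_num) (by have := Real.add_one_le_exp (1 : ℝ); linarith)
    calc Real.exp (-(w / (k ^ 2 : ℕ) ^ 2)) ≤ Real.exp (-((k ^ 2 : ℕ) : ℝ)) :=
          Real.exp_le_exp.2 (by linarith)
      _ = Real.exp (-1) ^ (k ^ 2) := by rw [← Real.exp_nat_mul]; congr 1; ring
      _ ≤ (1 / 2) ^ (k ^ 2) := pow_le_pow_left₀ (Real.exp_pos _).le h3 _
  have h4 : 2 ^ p * (2 ^ k + 1) * k ^ 2 < 2 ^ k ^ 2 := by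
    have a1 : 2 ^ k + 1 ≤ 2 ^ (k + 1) := by
      have : 1 ≤ 2 ^ k := Nat.one_le_two_pow
      rw [pow_succ]; omega
    have a2 : k ^ 2 < 2 ^ (2 * k) := by
      rw [mul_comm, pow_mul]
      exact Nat.pow_lt_pow_left Nat.lt_two_pow_self (by norm_num)
    calc 2 ^ p * (2 ^ k + 1) * k ^ 2 ≤ 2 ^ p * 2 ^ (k + 1) * 2 ^ (2 * k) := by gcongr
      _ = 2 ^ (p + (k + 1) + 2 * k) := by rw [pow_add 2 (p + (k + 1)), pow_add 2 p]
      _ < 2 ^ k ^ 2 := by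
          refine Nat.pow_lt_pow_right (by norm_num) ?_
          nlinarith
  have h5 : ((2 ^ p * (2 ^ k + 1) : ℕ) * (k ^ 2 : ℕ) : ℝ) < 2 ^ k ^ 2 := by exact_mod_cast h4
  calc ((2 ^ p * (2 ^ k + 1) : ℕ) * (k ^ 2 : ℕ) : ℝ) * Real.exp (-(w / (k ^ 2 : ℕ) ^ 2))
      ≤ ((2 ^ p * (2 ^ k + 1) : ℕ) * (k ^ 2 : ℕ) : ℝ) * (1 / 2) ^ (k ^ 2) := by gcongr
    _ < 2 ^ k ^ 2 * (1 / 2) ^ (k ^ 2) := by gcongr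
    _ = 1 := by rw [← mul_pow]; norm_num

lemma eventually_pow_mul_le_two_pow (C j : ℕ) : ∀ᶠ k : ℕ in atTop, k ^ j * C ≤ 2 ^ k := by
  have h := tendsto_pow_const_div_const_pow_of_one_lt j (r := (2 : ℝ)) (by norm_num)
  have h2 := (h.mul_const (C : ℝ)).eventually (eventually_le_nhds (b := 1) (by simp))
  filter_upwards [h2] with k hk
  rw [div_mul_eq_mul_div, div_le_one (by positivity)] at hk
  exact_mod_cast hk

variable {G : Type*} [AddCommGroup G] [Fintype G] [DecidableEq G] [Module (ZMod 2) G]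

lemma card_filter_le_of_imp_or {α : Type*} [Fintype α] {P P₁ P₂ P₃ : α → Prop} [DecidablePred P]
    [DecidablePred P₁] [DecidablePred P₂] [DecidablePred P₃]
    (h : ∀ a, P a → P₁ a ∨ P₂ a ∨ P₃ a) {x₁ x₂ x₃ : ℝ}
    (h₁ : ((Finset.univ.filter P₁).card : ℝ) ≤ x₁) (h₂ : ((Finset.univ.filter P₂).card : ℝ) ≤ x₂)
    (h₃ : ((Finset.univ.filter P₃).card : ℝ) ≤ x₃) :
    ((Finset.univ.filter P).card : ℝ) ≤ x₁ + (x₂ + x₃) := by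
  classical
  have h0 : (Finset.univ.filter P).card ≤ (Finset.univ.filter P₁).card +
      ((Finset.univ.filter P₂).card + (Finset.univ.filter P₃).card) := by
    refine (Finset.card_le_card (t := Finset.univ.filter P₁ ∪
      (Finset.univ.filter P₂ ∪ Finset.univ.filter P₃)) fun a ha => ?_).trans
      ((Finset.card_union_le _ _).trans (Nat.add_le_add_left (Finset.card_union_le _ _) _))
    simpa using h a (Finset.mem_filter.1 ha).2
  have h0' : ((Finset.univ.filter P).card : ℝ) ≤ (Finset.univ.filter P₁).card +
      ((Finset.univ.filter P₂).card + (Finset.univ.filter P₃).card) := by exact_mod_cast h0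
  linarith

lemma card_large_clique_le_of_parameters {n k p R D t w g b d e q a : ℕ}
    (hn : Fintype.card G = 2 ^ n) (hp : 2 ^ 16 ≤ p) (hk : 2 ^ 15 ≤ k) (hnk : n * k ≤ 2 ^ (k + 1))
    (hR : (2 ^ p) ^ 4 + p + k + 1 ≤ R) (hD : 0 < D)
    (hexp : ((2 ^ p * (2 ^ k + 1) : ℕ) * D : ℝ) * Real.exp (-(w / D ^ 2)) < 1)
    (ht : 2 ^ k + 1 ≤ t * D) (hg : 2 ≤ g) (hgb : g + 2 * w + 2 * b ≤ 2 * (2 ^ k + 1))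
    (heb : 2 ^ p * (2 ^ k + 1) * (2 * w) ≤ e * b) (hb : 0 < b) (hgd : g + d ≤ 2 ^ (k + 1))
    (hed : 3 * e < d) (hq : 2 ^ k ≤ q * (d - 2 * e)) (he : e < 2 ^ k)
    (hsample : n * R + R * t + 1 + k ≤ g) (ha : a ≤ k)
    (hperiodic : n * R + R * (k + q + 1) + (a * e + 2 ^ (k - a + 1)) + 1 + k ≤ 2 ^ (k + 1) - e) :
    ((Finset.univ.filter fun A : Finset G => ∃ X : Finset G, X.card = 2 ^ k + 1 ∧
        (0 : G) ∈ X ∧ (X + X).erase 0 ⊆ A).card : ℝ) ≤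
      2 ^ Fintype.card G * (3 * (1 / 2) ^ k) := by
  have hcover : ∀ A : Finset G, (∃ X : Finset G, X.card = 2 ^ k + 1 ∧
        (0 : G) ∈ X ∧ (X + X).erase 0 ⊆ A) →
      (∃ X : Finset G, X.card = 2 ^ k + 1 ∧ 2 ^ p * X.card ≤ (X + X).card ∧
        (X + X).erase 0 ⊆ A) ∨
      (∃ S ∈ sampleFamily G R t g, S.erase 0 ⊆ A) ∨
      (∃ S ∈ periodicFamily G R k q e (2 ^ (k + 1) - e), S.erase 0 ⊆ A) := by
    rintro A ⟨X, hXc, hX0, hXA⟩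
    by_cases hdb : 2 ^ p * X.card ≤ (X + X).card
    · exact Or.inl ⟨X, hXc, hdb, hXA⟩
    · right
      push Not at hdb
      obtain ⟨E, hEX, hE, hsp⟩ := exists_finset_linearIndepOn_subset_span X
      -- Doubling below 2^p gives rank at most (2^p)^4 + p + (k + 1); only the coefficient 1 of k
      -- matters.
      have hER : E.card ≤ R := by
        have h1 := two_pow_card_le_of_linearIndepOn hX0 hEX hE hdb.le
        have hm : 2 ^ k + 1 ≤ 2 ^ (k + 1) := by
          have : 1 ≤ 2 ^ k := Nat.one_le_two_pow
          rw [pow_succ]; omega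
        have h2 : 2 ^ E.card ≤ 2 ^ ((2 ^ p) ^ 4 + (p + (k + 1))) := by
          refine h1.trans ?_
          rw [hXc, pow_add 2 ((2 ^ p) ^ 4), pow_add 2 p]
          gcongr
        exact ((Nat.pow_le_pow_iff_right (by norm_num)).1 h2).trans
          (le_trans (le_of_eq (by ring)) hR)
      rw [← hXc] at hexp ht hgb heb
      rcases exists_mem_family_subset_add hXc hdb.le hER hsp hD hexp ht hg hgb heb hb hgd hed hq he
        with ⟨S, hS, hSX⟩ | ⟨S, hS, hSX⟩
      · exact Or.inl ⟨S, hS, (Finset.erase_subset_erase 0 hSX).trans hXA⟩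
      · exact Or.inr ⟨S, hS, (Finset.erase_subset_erase 0 hSX).trans hXA⟩
  have b1 := card_large_doubling_le hn hp hk hnk
  have b2 := card_sample_le hn hsample
  have b3 := card_periodic_le hn ha hperiodic
  refine (card_filter_le_of_imp_or hcover b1 b2 b3).trans (le_of_eq ?_)
  rw [show (3 : ℝ) * (1 / 2) ^ k = (1 / 2) ^ k + ((1 / 2) ^ k + (1 / 2) ^ k) by ring, mul_add,
    mul_add]

/-- The slack is measured in units Q = 2^(k-i-3): the hypothesis on n says nk ≤ 2^(k+1) - 8Q, and
every error term fits into a bounded number of Q. The threshold g = 2^(k+1) - 4Q leaves 4Q for the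
overhead of sampling and d = 4Q for Kneser's theorem. -/
lemma card_large_clique_le_of_large {i p k n : ℕ} (hn : Fintype.card G = 2 ^ n)
    (hp : 2 ^ 16 ≤ p) (hk₁ : 2 ^ 15 ≤ k) (hk₂ : p + 5 ≤ k)
    (hk₃ : ((2 ^ p) ^ 4 + p + 1) * 2 ^ (i + 4) ≤ k) (hk₄ : 2 ^ (i + 6) ≤ k)
    (hk₅ : k ^ 6 * 2 ^ (p + 3 * i + 13) ≤ 2 ^ k)
    (h : (2 ^ i + 1) * (n * k) ≤ 2 ^ (i + k + 1)) :
    ((Finset.univ.filter fun A : Finset G => ∃ X : Finset G, X.card = 2 ^ k + 1 ∧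
        (0 : G) ∈ X ∧ (X + X).erase 0 ⊆ A).card : ℝ) ≤
      2 ^ Fintype.card G * (3 * (1 / 2) ^ k) := by
  have hki : p + 3 * i + 13 ≤ k := by
    have h1 : 2 ^ (p + 3 * i + 13) ≤ 2 ^ k :=
      le_trans (Nat.le_mul_of_pos_left _ (pow_pos (by omega) 6)) hk₅
    exact (Nat.pow_le_pow_iff_right (by norm_num)).1 h1
  obtain ⟨Q, hQ⟩ : ∃ Q, Q = 2 ^ (k - i - 3) := ⟨_, rfl⟩
  have hM : 2 ^ k = 2 ^ (i + 3) * Q := by rw [hQ, ← pow_add]; congr 1; omega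
  have hM8 : 2 ^ k = 8 * (2 ^ i * Q) := by rw [hM, pow_add]; ring
  have hQ0 : 0 < Q := by rw [hQ]; positivity
  have hk0 : 0 < k := by omega
  obtain ⟨C, hC⟩ : ∃ C, C = (2 ^ p) ^ 4 + p + 1 := ⟨_, rfl⟩
  rw [← hC] at hk₃
  -- The exponent of e gives (i + 5) e ≤ Q; that of w is the largest for which 2^p · 2^(k+1) · 2w ≤
  -- eQ.
  obtain ⟨e, he⟩ : ∃ e, e = 2 ^ (k - (2 * i + 8)) := ⟨_, rfl⟩
  obtain ⟨w, hw⟩ : ∃ w, w = 2 ^ (k - (p + 3 * i + 13)) := ⟨_, rfl⟩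
  -- `u = n k` satisfies `u + 8 Q ≤ 2 ^ (k + 1)`
  have hu : n * k + 8 * Q ≤ 2 ^ (k + 1) := by
    have h1 : 1 ≤ 2 ^ i := Nat.one_le_two_pow
    have h2 : 2 ^ (i + k + 1) = 2 * (2 ^ i * 2 ^ k) := by rw [pow_succ, pow_add]; ring
    rw [h2, hM8] at h
    rw [pow_succ, hM8]
    by_contra hcon
    push Not at hcon
    have h3 : (2 ^ i + 1) * (8 * (2 ^ i * Q) * 2) < (2 ^ i + 1) * (n * k + 8 * Q) :=
      Nat.mul_lt_mul_of_pos_left hcon (by positivity)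
    nlinarith [Nat.mul_le_mul_right Q h1]
  have hnk : n * k ≤ 2 ^ (k + 1) := by omega
  have hk₃' : C ≤ k := le_trans (Nat.le_mul_of_pos_right _ (by positivity)) hk₃
  have hnC : n * C ≤ Q := by
    refine Nat.le_of_mul_le_mul_right (c := k) ?_ hk0
    calc n * C * k = n * k * C := by ring
      _ ≤ 2 ^ (k + 1) * C := Nat.mul_le_mul_right _ hnk
      _ = C * 2 ^ (i + 4) * Q := by rw [pow_succ, hM]; ring
      _ ≤ k * Q := Nat.mul_le_mul_right _ hk₃
      _ = Q * k := mul_comm _ _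
  have heQ : (i + 5) * e ≤ Q := by
    have h1 : i + 5 ≤ 2 ^ (i + 5) := Nat.lt_two_pow_self.le
    calc (i + 5) * e ≤ 2 ^ (i + 5) * e := Nat.mul_le_mul_right _ h1
      _ = Q := by rw [he, hQ, ← pow_add]; congr 1; omega
  have he0 : 0 < e := by rw [he]; positivity
  have he5 : 5 * e ≤ Q := (Nat.mul_le_mul_right e (by omega)).trans heQ
  have he4 : (i + 4) * e + e ≤ Q := le_trans (le_of_eq (by ring)) heQ
  have hk6Q : 8 * k ^ 2 ≤ Q := by
    have h1 : k ^ 6 * 2 ^ (p + 2 * i + 10) * 2 ^ (i + 3) ≤ Q * 2 ^ (i + 3) := by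
      rw [mul_assoc, ← pow_add, mul_comm Q, ← hM]
      refine le_trans (le_of_eq ?_) hk₅
      congr 2
      omega
    have h2 := Nat.le_of_mul_le_mul_right h1 (by positivity)
    have h3 : k ^ 2 ≤ k ^ 6 := Nat.pow_le_pow_right hk0 (by norm_num)
    have h4 : 8 ≤ 2 ^ (p + 2 * i + 10) :=
      calc 8 = 2 ^ 3 := by norm_num
        _ ≤ 2 ^ (p + 2 * i + 10) := Nat.pow_le_pow_right (by norm_num) (by omega)
    calc 8 * k ^ 2 = k ^ 2 * 8 := mul_comm _ _
      _ ≤ k ^ 6 * 2 ^ (p + 2 * i + 10) := Nat.mul_le_mul h3 h4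
      _ ≤ Q := h2
  have hwk : k ^ 6 ≤ w := by
    have h1 : k ^ 6 * 2 ^ (p + 3 * i + 13) ≤ w * 2 ^ (p + 3 * i + 13) := by
      refine hk₅.trans (le_of_eq ?_)
      rw [hw, ← pow_add]
      congr 1
      omega
    exact Nat.le_of_mul_le_mul_right h1 (by positivity)
  have hwQ : w ≤ Q := by
    rw [hw, hQ]
    exact Nat.pow_le_pow_right (by norm_num) (by omega)
  obtain ⟨m, hm⟩ : ∃ m, m = 2 ^ k + 1 := ⟨_, rfl⟩
  have hm2 : m ≤ 2 ^ (k + 1) := by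
    have : 1 ≤ 2 ^ k := Nat.one_le_two_pow
    rw [hm, pow_succ]; omega
  obtain ⟨t, ht⟩ : ∃ t, t = m / k ^ 2 + 1 := ⟨_, rfl⟩
  have hk2 : 0 < k ^ 2 := by positivity
  have hRt : (k + C) * t ≤ 2 * Q := by
    have h1 : 2 * k * (m / k ^ 2) ≤ Q := by
      refine Nat.le_of_mul_le_mul_right (c := k) ?_ hk0
      have h2 : k ^ 2 * (m / k ^ 2) ≤ m := Nat.mul_div_le _ _
      calc 2 * k * (m / k ^ 2) * k = 2 * (k ^ 2 * (m / k ^ 2)) := by ring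
        _ ≤ 2 * 2 ^ (k + 1) := Nat.mul_le_mul_left _ (h2.trans hm2)
        _ = 2 ^ (i + 5) * Q := by rw [pow_succ, hM]; ring
        _ ≤ 2 ^ (i + 6) * Q :=
            Nat.mul_le_mul_right _ (Nat.pow_le_pow_right (by norm_num) (by omega))
        _ ≤ k * Q := Nat.mul_le_mul_right _ hk₄
        _ = Q * k := mul_comm _ _
    calc (k + C) * t ≤ (2 * k) * t := Nat.mul_le_mul_right _ (by omega)
      _ = 2 * k * (m / k ^ 2) + 2 * k := by rw [ht]; ring
      _ ≤ 2 * Q := by nlinarith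
  have hq : (k + C) * (k + 2 ^ (i + 2) + 1) + k + 1 ≤ Q := by
    have h1 : 2 ^ (i + 2) + 1 ≤ k := by
      refine le_trans ?_ hk₄
      have : 2 ^ (i + 6) = 16 * 2 ^ (i + 2) := by rw [show i + 6 = i + 2 + 4 by ring, pow_add]; ring
      have : 1 ≤ 2 ^ (i + 2) := Nat.one_le_two_pow
      omega
    calc (k + C) * (k + 2 ^ (i + 2) + 1) + k + 1 ≤ (2 * k) * (2 * k) + k + 1 := by
          gcongr <;> omega
      _ ≤ 8 * k ^ 2 := by nlinarith
      _ ≤ Q := hk6Q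
  have hp1 : 2 ^ (k + 1) = 2 * 2 ^ k := by rw [pow_succ, mul_comm]
  have hQM : 8 * Q ≤ 2 ^ k := by
    rw [hM8]
    exact Nat.mul_le_mul_left _ (Nat.le_mul_of_pos_left _ (by positivity))
  rw [hm] at hm2
  refine card_large_clique_le_of_parameters (R := k + C) (D := k ^ 2) (t := t)
    (w := w) (g := 2 ^ (k + 1) - 4 * Q) (b := Q) (d := 4 * Q) (e := e) (q := 2 ^ (i + 2))
    (a := i + 4) hn hp hk₁ hnk (by rw [hC]; exact le_of_eq (by ring)) hk2
    (sampling_exp_lt_one hk₂ hwk) ?_ ?_ ?_ ?_ hQ0 ?_ ?_ ?_ ?_ ?_ ?_ ?_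
  · rw [ht, hm, add_mul, one_mul]
    exact (Nat.lt_div_mul_add hk2).le
  · clear * - hp1 hQM hQ0
    omega
  · clear * - hp1 hQM hQ0 hwQ
    omega
  · calc 2 ^ p * (2 ^ k + 1) * (2 * w) ≤ 2 ^ p * 2 ^ (k + 1) * (2 * w) := by gcongr
      _ = 2 ^ (p + (k + 1) + (1 + (k - (p + 3 * i + 13)))) := by
          rw [hw, pow_add 2 (p + (k + 1)), pow_add 2 1, pow_add 2 p, pow_one]
      _ ≤ 2 ^ ((k - (2 * i + 8)) + (k - i - 3)) := by
          refine Nat.pow_le_pow_right (by norm_num) ?_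
          clear * - hki
          omega
      _ = e * Q := by rw [pow_add, he, hQ]
  · clear * - hp1 hQM
    omega
  · clear * - he5 hQ0
    omega
  · rw [hM, show i + 3 = i + 2 + 1 by ring, pow_succ, mul_assoc]
    refine Nat.mul_le_mul_left _ ?_
    clear * - he5
    omega
  · clear * - he5 hQM hQ0
    omega
  · rw [mul_add n]
    clear * - hu hnC hRt hq hQM hp1
    omega
  · clear * - hki
    omega
  · have h1 : 2 ^ (k - (i + 4) + 1) = Q := by
      rw [hQ]
      congr 1
      clear * - hki
      omega
    rw [h1, mul_add n]
    clear * - hu hnC hq he4 hQM hp1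
    omega

/-- With high probability there is no set of `2 ^ k + 1` elements all of whose nonzero sums lie in
the random set. -/
theorem eventually_card_large_clique_le (i : ℕ) : ∀ᶠ k : ℕ in atTop, ∀ n : ℕ,
    (2 ^ i + 1) * (n * k) ≤ 2 ^ (i + k + 1) →
    ((Finset.univ.filter fun A : Finset (F2 n) => ∃ X : Finset (F2 n), X.card = 2 ^ k + 1 ∧
        (0 : F2 n) ∈ X ∧ (X + X).erase 0 ⊆ A).card : ℝ) ≤
      2 ^ Fintype.card (F2 n) * (3 * (1 / 2) ^ k) := by
  -- Only the inequality on p is retained, so that 2^p stays symbolic.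
  obtain ⟨p, hp⟩ : ∃ p : ℕ, 2 ^ 16 ≤ p := ⟨_, le_rfl⟩
  filter_upwards [eventually_ge_atTop (2 ^ 15), eventually_ge_atTop (p + 5),
    eventually_ge_atTop (((2 ^ p) ^ 4 + p + 1) * 2 ^ (i + 4)), eventually_ge_atTop (2 ^ (i + 6)),
    eventually_pow_mul_le_two_pow (2 ^ (p + 3 * i + 13)) 6] with k h1 h2 h3 h4 h5 n h
  refine card_large_clique_le_of_large (i := i) ?_ hp h1 h2 h3 h4 h5 h
  simp [F2, ZMod.card]

end UpperBoundConclusion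

/-! ### Second moment method for graphs of linear maps. -/

section LowerBound

variable {V W : Type*} [AddCommGroup V] [Module (ZMod 2) V] [Fintype V] [DecidableEq V]
  [AddCommGroup W] [Module (ZMod 2) W] [Fintype W] [DecidableEq W] [Fintype (V →ₗ[ZMod 2] W)]

set_option linter.unusedSectionVars false

/-- Independent vectors u can be sent to arbitrary w by a map N w; translating the maps that kill u
by the various N w gives |W|^j disjoint copies. -/
lemma card_linearMap_vanishing_mul_le {j : ℕ} {u : Fin j → V} (hu : LinearIndependent (ZMod 2) u) :
    (Finset.univ.filter fun M : V →ₗ[ZMod 2] W => ∀ i, M (u i) = 0).card * Fintype.card W ^ j ≤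
      Fintype.card (V →ₗ[ZMod 2] W) := by
  classical
  obtain ⟨g, hg⟩ := LinearMap.exists_leftInverse_of_injective
    (Fintype.linearCombination (ZMod 2) u) (LinearMap.ker_eq_bot.2
      (LinearIndependent.fintypeLinearCombination_injective hu))
  have hgu : ∀ i, g (u i) = Pi.single i 1 := by
    intro i
    have h := LinearMap.congr_fun hg (Pi.single i 1)
    rw [LinearMap.comp_apply, Fintype.linearCombination_apply_single, one_smul] at h
    exact h
  let N : (Fin j → W) → (V →ₗ[ZMod 2] W) := fun w => (Fintype.linearCombination (ZMod 2) w).comp g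
  have hN : ∀ w i, N w (u i) = w i := by
    intro w i
    simp only [N, LinearMap.comp_apply, hgu, Fintype.linearCombination_apply_single, one_smul]
  have hW : Fintype.card W ^ j = (Finset.univ : Finset (Fin j → W)).card := by
    rw [Finset.card_univ, Fintype.card_fun, Fintype.card_fin]
  rw [hW, ← Finset.card_product, ← Finset.card_univ]
  refine Finset.card_le_card_of_injOn (fun p => p.1 + N p.2) (fun _ _ => Finset.mem_univ _) ?_
  rintro ⟨M, w⟩ h ⟨M', w'⟩ h' heq
  simp only [Finset.coe_product, Set.mem_prod, Finset.coe_filter, Finset.mem_univ, true_and,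
    Set.mem_ofPred_eq, Finset.coe_univ, Set.mem_univ, and_true] at h h'
  have hww : w = w' := by
    funext i
    have := LinearMap.congr_fun heq (u i)
    simpa [h i, h' i, hN] using this
  subst hww
  exact Prod.ext (add_right_cancel heq) rfl

/-- Union bound over the possible bases of the kernel. -/
lemma card_linearMap_finrank_ker_eq_mul_le (j : ℕ) :
    (Finset.univ.filter fun M : V →ₗ[ZMod 2] W =>
      Module.finrank (ZMod 2) (LinearMap.ker M) = j).card * Fintype.card W ^ j ≤
        Fintype.card V ^ j * Fintype.card (V →ₗ[ZMod 2] W) := by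
  classical
  have hsub : (Finset.univ.filter fun M : V →ₗ[ZMod 2] W =>
      Module.finrank (ZMod 2) (LinearMap.ker M) = j) ⊆
      (Finset.univ.filter fun u : Fin j → V => LinearIndependent (ZMod 2) u).biUnion fun u =>
        Finset.univ.filter fun M : V →ₗ[ZMod 2] W => ∀ i, M (u i) = 0 := by
    intro M hM
    rw [Finset.mem_filter] at hM
    let b := Module.finBasisOfFinrankEq (ZMod 2) (LinearMap.ker M) hM.2
    rw [Finset.mem_biUnion]
    refine ⟨fun i => (b i : V), ?_, ?_⟩
    · simp only [Finset.mem_filter, Finset.mem_univ, true_and]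
      exact b.linearIndependent.map' (LinearMap.ker M).subtype (Submodule.ker_subtype _)
    · simp
  calc _ ≤ (∑ u ∈ Finset.univ.filter fun u : Fin j → V => LinearIndependent (ZMod 2) u,
        (Finset.univ.filter fun M : V →ₗ[ZMod 2] W => ∀ i, M (u i) = 0).card) *
          Fintype.card W ^ j :=
        Nat.mul_le_mul_right _ ((Finset.card_le_card hsub).trans Finset.card_biUnion_le)
    _ ≤ (Finset.univ.filter fun u : Fin j → V => LinearIndependent (ZMod 2) u).card *
          Fintype.card (V →ₗ[ZMod 2] W) := by
        rw [Finset.sum_mul, ← smul_eq_mul _ (Fintype.card (V →ₗ[ZMod 2] W))]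
        refine Finset.sum_le_card_nsmul _ _ _ fun u hu => ?_
        exact card_linearMap_vanishing_mul_le (Finset.mem_filter.1 hu).2
    _ ≤ Fintype.card V ^ j * Fintype.card (V →ₗ[ZMod 2] W) := by
        refine Nat.mul_le_mul_right _ ((Finset.card_le_univ _).trans (le_of_eq ?_))
        rw [Fintype.card_fun, Fintype.card_fin]

/-- By convexity (2^j - 1) / j increases with j, so the second moment need only be controlled at the
extreme kernel dimension k. -/
lemma mul_two_pow_sub_one_le {k j : ℕ} (hjk : j ≤ k) :
    k * (2 ^ j - 1) ≤ j * (2 ^ k - 1) := by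
  induction k, hjk using Nat.le_induction with
  | base => exact le_rfl
  | succ k hjk ih =>
    rcases Nat.eq_zero_or_pos j with rfl | hj
    · simp
    have h1 : 2 ^ j ≤ 2 ^ k := Nat.pow_le_pow_right (by norm_num) hjk
    have h2 : 1 ≤ 2 ^ j := Nat.one_le_two_pow
    obtain ⟨x, hx⟩ := Nat.exists_eq_add_of_le h2
    obtain ⟨y, hy⟩ := Nat.exists_eq_add_of_le (h2.trans h1)
    have h4 : x ≤ y := by omega
    have h3 : (1 + y) * 2 - 1 = 2 * y + 1 := by omega
    rw [hx, hy, Nat.add_sub_cancel_left, Nat.add_sub_cancel_left] at ih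
    rw [pow_succ, hx, hy, h3, Nat.add_sub_cancel_left]
    nlinarith [Nat.mul_le_mul_right y hj]

/-- The number of nonzero elements of the kernel. -/
def kerCount (M : V →ₗ[ZMod 2] W) : ℕ := (Finset.univ.filter fun v : V => v ≠ 0 ∧ M v = 0).card

lemma kerCount_add_one (M : V →ₗ[ZMod 2] W) :
    kerCount M + 1 = 2 ^ Module.finrank (ZMod 2) (LinearMap.ker M) := by
  classical
  have h1 : Fintype.card (LinearMap.ker M) = 2 ^ Module.finrank (ZMod 2) (LinearMap.ker M) := by
    rw [Module.card_eq_pow_finrank (K := ZMod 2), ZMod.card]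
  rw [← h1, Fintype.card_subtype]
  have h2 : (Finset.univ.filter fun v : V => v ∈ LinearMap.ker M) =
      insert 0 (Finset.univ.filter fun v : V => v ≠ 0 ∧ M v = 0) := by
    ext v
    by_cases hv : v = 0 <;> simp [hv]
  rw [h2, Finset.card_insert_of_notMem (by simp), kerCount]

/-- Kernels of dimension j ≥ 1 have frequency at most 2^(kj - dj) and weight 2^(2^j - 1). The
hypothesis scaled by j/k makes each such product at most 2^(-y), and there are k values of j. -/
lemma sum_two_pow_kerCount_le {k d y : ℕ} (hV : Fintype.card V = 2 ^ k)
    (hW : Fintype.card W = 2 ^ d) (h : k * (y + k) + 2 ^ k ≤ k * d) :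
    ∑ M : V →ₗ[ZMod 2] W, (2 : ℝ) ^ kerCount M ≤
      Fintype.card (V →ₗ[ZMod 2] W) * (1 + k * (1 / 2) ^ y) := by
  classical
  have hVk : Module.finrank (ZMod 2) V = k := by
    have := Module.card_eq_pow_finrank (K := ZMod 2) (V := V)
    rw [hV, ZMod.card] at this
    exact (Nat.pow_right_injective le_rfl this).symm
  have hle : ∀ M : V →ₗ[ZMod 2] W, Module.finrank (ZMod 2) (LinearMap.ker M) ∈
      Finset.range (k + 1) := by
    intro M
    rw [Finset.mem_range, Nat.lt_succ_iff, ← hVk]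
    exact Submodule.finrank_le _
  rw [← Finset.sum_fiberwise_of_maps_to (fun M _ => hle M), Finset.sum_range_succ']
  rw [mul_add, mul_one, add_comm]
  refine add_le_add ?_ ?_
  · refine (Finset.sum_le_card_nsmul _ _ 1 fun M hM => ?_).trans ?_
    · have h1 := kerCount_add_one M
      rw [(Finset.mem_filter.1 hM).2] at h1
      have : kerCount M = 0 := by simpa using h1
      rw [this, pow_zero]
    · rw [nsmul_eq_mul, mul_one]
      exact_mod_cast Finset.card_le_univ _
  · refine (Finset.sum_le_card_nsmul _ _ (Fintype.card (V →ₗ[ZMod 2] W) * (1 / 2) ^ y : ℝ)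
      fun j hj => ?_).trans (le_of_eq ?_)
    · rw [Finset.mem_range] at hj
      have h1 : ∀ M ∈ Finset.univ.filter fun M : V →ₗ[ZMod 2] W =>
          Module.finrank (ZMod 2) (LinearMap.ker M) = j + 1, (2 : ℝ) ^ kerCount M ≤
          2 ^ (2 ^ (j + 1) - 1) := by
        intro M hM
        have h1 := kerCount_add_one M
        rw [(Finset.mem_filter.1 hM).2] at h1
        rw [← h1, Nat.add_sub_cancel]
      refine (Finset.sum_le_card_nsmul _ _ _ h1).trans ?_
      rw [nsmul_eq_mul]
      have h2 := card_linearMap_finrank_ker_eq_mul_le (V := V) (W := W) (j + 1)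
      rw [hV, hW, ← pow_mul, ← pow_mul] at h2
      have h3 : k * (j + 1) + (2 ^ (j + 1) - 1) + y ≤ d * (j + 1) := by
        have h4 := mul_two_pow_sub_one_le (show j + 1 ≤ k by omega)
        refine Nat.le_of_mul_le_mul_left (c := k) ?_ (by omega)
        have h5 : (j + 1) * (k * (y + k) + 2 ^ k) ≤ (j + 1) * (k * d) := Nat.mul_le_mul_left _ h
        have h6 : (j + 1) * (2 ^ k - 1) ≤ (j + 1) * 2 ^ k := Nat.mul_le_mul_left _ (by omega)
        have h7 : k * y ≤ (j + 1) * (k * y) := Nat.le_mul_of_pos_left _ (by omega)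
        nlinarith
      set c := (Finset.univ.filter fun M : V →ₗ[ZMod 2] W =>
          Module.finrank (ZMod 2) (LinearMap.ker M) = j + 1).card with hc
      have h2' : (c : ℝ) * 2 ^ (d * (j + 1)) ≤
          2 ^ (k * (j + 1)) * Fintype.card (V →ₗ[ZMod 2] W) := by exact_mod_cast h2
      have h8 : (2 : ℝ) ^ (k * (j + 1) + (2 ^ (j + 1) - 1) + y) ≤ 2 ^ (d * (j + 1)) :=
        pow_le_pow_right₀ (by norm_num) h3
      rw [pow_add, pow_add] at h8
      rw [one_div, inv_pow, ← div_eq_mul_inv, le_div_iff₀ (by positivity)]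
      have h9 : (0 : ℝ) < 2 ^ (k * (j + 1)) := by positivity
      have h10 : (2 : ℝ) ^ (k * (j + 1)) * ((c : ℝ) * 2 ^ (2 ^ (j + 1) - 1) * 2 ^ y) ≤
          2 ^ (k * (j + 1)) * Fintype.card (V →ₗ[ZMod 2] W) := by
        refine le_trans ?_ h2'
        calc (2 : ℝ) ^ (k * (j + 1)) * ((c : ℝ) * 2 ^ (2 ^ (j + 1) - 1) * 2 ^ y)
            = (c : ℝ) * ((2 : ℝ) ^ (k * (j + 1)) * 2 ^ (2 ^ (j + 1) - 1) * 2 ^ y) := by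
              rw [mul_assoc (c : ℝ), mul_left_comm, mul_assoc ((2 : ℝ) ^ (k * (j + 1)))]
          _ ≤ (c : ℝ) * (2 : ℝ) ^ (d * (j + 1)) := by gcongr
      exact le_of_mul_le_mul_left h10 h9
    · rw [Finset.card_range, nsmul_eq_mul]
      ring

variable {G : Type*} [AddCommGroup G] [Fintype G] [DecidableEq G]

/-- The nonzero elements of the graph of a linear map. -/
def graphFinset (ι : V × W → G) (M : V →ₗ[ZMod 2] W) : Finset G :=
  (Finset.univ.filter fun v : V => v ≠ 0).image fun v => ι (v, M v)

lemma card_graphFinset {ι : V × W → G} (hι : Function.Injective ι) (M : V →ₗ[ZMod 2] W) :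
    (graphFinset ι M).card = Fintype.card V - 1 := by
  rw [graphFinset, Finset.card_image_of_injective, Finset.filter_ne', Finset.card_erase_of_mem
    (Finset.mem_univ _), Finset.card_univ]
  intro v v' h
  exact (Prod.mk.inj (hι h)).1

lemma card_graphFinset_inter {ι : V × W → G} (hι : Function.Injective ι) (M M' : V →ₗ[ZMod 2] W) :
    (graphFinset ι M ∩ graphFinset ι M').card = kerCount (M - M') := by
  have h : graphFinset ι M ∩ graphFinset ι M' =
      (Finset.univ.filter fun v : V => v ≠ 0 ∧ (M - M') v = 0).image fun v => ι (v, M v) := by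
    ext x
    simp only [graphFinset, Finset.mem_inter, Finset.mem_image, Finset.mem_filter, Finset.mem_univ,
      true_and, LinearMap.sub_apply, sub_eq_zero]
    constructor
    · rintro ⟨⟨v, hv, rfl⟩, v', hv', h⟩
      obtain ⟨h1, h2⟩ := Prod.mk.inj (hι h)
      subst h1
      exact ⟨v', ⟨hv, h2.symm⟩, rfl⟩
    · rintro ⟨v, ⟨hv, hM⟩, rfl⟩
      exact ⟨⟨v, hv, rfl⟩, v, hv, by rw [hM]⟩
  rw [h, Finset.card_image_of_injective, kerCount]
  intro v v' h
  exact (Prod.mk.inj (hι h)).1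

/-- The second moment method for the number of linear maps whose graph lies in a random set. -/
theorem le_card_exists_graphFinset_subset {k d y : ℕ} {ι : V × W → G} (hι : Function.Injective ι)
    (hV : Fintype.card V = 2 ^ k) (hW : Fintype.card W = 2 ^ d)
    (h : k * (y + k) + 2 ^ k ≤ k * d) :
    (2 : ℝ) ^ Fintype.card G ≤ (1 + k * (1 / 2) ^ y) *
      (Finset.univ.filter fun A : Finset G =>
        ∃ M : V →ₗ[ZMod 2] W, graphFinset ι M ⊆ A).card := by
  set I := V →ₗ[ZMod 2] W with hI
  set N := Fintype.card G with hN
  set s := Fintype.card V - 1 with hs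
  let f : Finset G → ℝ := fun A => ∑ M : I, if graphFinset ι M ⊆ A then 1 else 0
  set Z := Finset.univ.filter fun A : Finset G => ∃ M : I, graphFinset ι M ⊆ A with hZ
  classical
  have hIpos : (0 : ℝ) < Fintype.card I := by
    exact_mod_cast Fintype.card_pos_iff.2 ⟨(0 : V →ₗ[ZMod 2] W)⟩
  have hcount : ∀ T : Finset G, ∑ A : Finset G, (if T ⊆ A then (1 : ℝ) else 0) =
      2 ^ N * (1 / 2) ^ T.card := by
    intro T
    rw [← card_filter_subset_eq, Finset.sum_boole]
  have hf1 : ∑ A : Finset G, f A = Fintype.card I * (2 ^ N * (1 / 2) ^ s) := by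
    simp only [f]
    rw [Finset.sum_comm]
    simp_rw [hcount, card_graphFinset hι]
    rw [Finset.sum_const, Finset.card_univ, nsmul_eq_mul]
  have hf2 : ∑ A : Finset G, f A ^ 2 = 2 ^ N * ((1 / 2) ^ s) ^ 2 *
      (Fintype.card I * ∑ M : I, (2 : ℝ) ^ kerCount M) := by
    have h1 : ∀ A, f A ^ 2 = ∑ M : I, ∑ M' : I,
        if graphFinset ι M ∪ graphFinset ι M' ⊆ A then 1 else 0 := by
      intro A
      simp only [f]
      rw [sq, Finset.sum_mul_sum]
      refine Finset.sum_congr rfl fun M _ => Finset.sum_congr rfl fun M' _ => ?_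
      simp only [Finset.union_subset_iff]
      by_cases h1 : graphFinset ι M ⊆ A <;> by_cases h2 : graphFinset ι M' ⊆ A <;> simp [h1, h2]
    simp_rw [h1]
    rw [Finset.sum_comm]
    have h2 : ∀ M : I, ∑ A : Finset G, ∑ M' : I,
        (if graphFinset ι M ∪ graphFinset ι M' ⊆ A then (1 : ℝ) else 0) =
        2 ^ N * ((1 / 2) ^ s) ^ 2 * ∑ M : I, (2 : ℝ) ^ kerCount M := by
      intro M
      rw [Finset.sum_comm]
      simp_rw [hcount]
      -- The union of the graphs of M and M' has 2s minus `kerCount (M - M')` elements, and M' ↦ M -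
      -- M' is a bijection.
      rw [← Equiv.sum_comp (Equiv.subLeft M) (fun M : I => (2 : ℝ) ^ kerCount M), Finset.mul_sum]
      refine Finset.sum_congr rfl fun M' _ => ?_
      have h3 := Finset.card_union_add_card_inter (graphFinset ι M) (graphFinset ι M')
      rw [card_graphFinset hι, card_graphFinset hι, card_graphFinset_inter hι, ← hs] at h3
      rw [Equiv.subLeft_apply, mul_assoc]
      congr 1
      rw [← pow_mul, mul_two, ← h3, pow_add, mul_assoc, ← mul_pow]
      norm_num
    simp_rw [h2]
    rw [Finset.sum_const, Finset.card_univ, nsmul_eq_mul]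
    ring
  have hf0 : ∀ A, A ∉ Z → f A = 0 := by
    intro A hA
    refine Finset.sum_eq_zero fun M _ => if_neg fun hM => hA ?_
    simp only [hZ, Finset.mem_filter, Finset.mem_univ, true_and]
    exact ⟨M, hM⟩
  -- Cauchy–Schwarz on the support of f, which lies in Z.
  have hcs : (∑ A : Finset G, f A) ^ 2 ≤ Z.card * ∑ A : Finset G, f A ^ 2 := by
    rw [← Finset.sum_subset (Finset.subset_univ Z) fun A _ hA => hf0 A hA]
    refine (sq_sum_le_card_mul_sum_sq).trans ?_
    refine mul_le_mul_of_nonneg_left ?_ (by positivity)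
    exact Finset.sum_le_sum_of_subset_of_nonneg (Finset.subset_univ Z) fun A _ _ => sq_nonneg _
  rw [hf1, hf2] at hcs
  have hT := sum_two_pow_kerCount_le (V := V) (W := W) hV hW h
  have hcs2 : (Fintype.card I * (2 ^ N * (1 / 2) ^ s) : ℝ) ^ 2 ≤
      Z.card * (2 ^ N * ((1 / 2) ^ s) ^ 2 *
        (Fintype.card I * (Fintype.card I * (1 + k * (1 / 2) ^ y)))) := by
    refine hcs.trans ?_
    gcongr
  have hpos : (0 : ℝ) < (Fintype.card I) ^ 2 * 2 ^ N * ((1 / 2) ^ s) ^ 2 := by positivity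
  suffices hZcard : (2 : ℝ) ^ N ≤ (1 + k * (1 / 2) ^ y) * Z.card by convert hZcard
  refine le_of_mul_le_mul_left ?_ hpos
  calc ((Fintype.card I : ℝ)) ^ 2 * 2 ^ N * ((1 / 2) ^ s) ^ 2 * 2 ^ N
      = (Fintype.card I * (2 ^ N * (1 / 2) ^ s) : ℝ) ^ 2 := by ring
    _ ≤ _ := hcs2
    _ = (Fintype.card I : ℝ) ^ 2 * 2 ^ N * ((1 / 2) ^ s) ^ 2 *
          ((1 + k * (1 / 2) ^ y) * Z.card) := by ring

end LowerBound

/-! ### Probabilities as proportions of finite sets. -/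

section RandomSubset

variable {G : Type*}

instance : IsProbabilityMeasure (randomSubset G) := by
  unfold randomSubset
  infer_instance

lemma randomSubset_real_setOf [Fintype G] (P : Set G → Prop)
    [DecidablePred fun A : Finset G => P A] :
    (randomSubset G).real {A | P A} =
      (Finset.univ.filter fun A : Finset G => P A).card / 2 ^ Fintype.card G := by
  classical
  have h1 : {A : Set G | P A} =
      ↑((Finset.univ.filter fun A : Finset G => P A).image fun A : Finset G => (A : Set G)) := by
    ext A
    simp only [Set.mem_ofPred_eq, Finset.coe_image, Finset.coe_filter, Finset.mem_univ, true_and,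
      Set.mem_image]
    constructor
    · intro hA
      exact ⟨A.toFinset, by simpa, by simp⟩
    · rintro ⟨B, hB, rfl⟩
      exact hB
  rw [h1, ← sum_measureReal_singleton, Finset.sum_image fun A _ B _ h => Finset.coe_injective h]
  have h2 : ∀ A : Finset G, (randomSubset G).real {(A : Set G)} = 1 / 2 ^ Fintype.card G := by
    intro A
    rw [randomSubset, setBernoulli_real_singleton _ (Set.subset_univ _) Set.finite_univ]
    have h3 := Set.ncard_sdiff_add_ncard_of_subset (Set.subset_univ (A : Set G))
    rw [Set.ncard_univ, Nat.card_eq_fintype_card] at h3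
    change (1 / 2 : ℝ) ^ _ * (1 - 1 / 2) ^ _ = _
    rw [sub_half, ← pow_add, ← h3, add_comm, one_div_pow]
  rw [Finset.sum_congr rfl fun A _ => h2 A, Finset.sum_const, nsmul_eq_mul, mul_one_div]

end RandomSubset

/-! ### Cliques, sumsets and the two-sided estimate. -/

section Clique

open scoped Pointwise

/-- Translation by a vertex x puts 0 into the clique and, as x + x = 0, leaves all pairwise sums
unchanged. The rank bound for small doubling needs this 0. -/
lemma exists_finset_card_eq_of_lt_cayleyCliqueNum {n m : ℕ} {A : Finset (F2 n)}
    (h : m < cayleyCliqueNum n A) :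
    ∃ X : Finset (F2 n), X.card = m + 1 ∧ 0 ∈ X ∧ (X + X).erase 0 ⊆ A := by
  obtain ⟨s, hs⟩ := (cayleySumGraph (A : Set (F2 n))).exists_isNClique_cliqueNum
  have hcard : m + 1 ≤ s.card := by
    rw [hs.card_eq]
    exact h
  obtain ⟨t, hts, htc⟩ := Finset.exists_subset_card_eq hcard
  obtain ⟨x, hx⟩ : t.Nonempty := Finset.card_pos.1 (by omega)
  refine ⟨t.image (· + x), ?_, ?_, ?_⟩
  · rw [Finset.card_image_of_injective _ (add_left_injective x), htc]
  · exact Finset.mem_image.2 ⟨x, hx, ZModModule.add_self x⟩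
  · intro a ha
    obtain ⟨ha0, ha⟩ := Finset.mem_erase.1 ha
    obtain ⟨_, hb, _, hc, rfl⟩ := Finset.mem_add.1 ha
    obtain ⟨b, hbt, rfl⟩ := Finset.mem_image.1 hb
    obtain ⟨c, hct, rfl⟩ := Finset.mem_image.1 hc
    have hbc : b + x + (c + x) = b + c := by
      rw [add_add_add_comm, ZModModule.add_self x, add_zero]
    rw [hbc] at ha0 ⊢
    have hne : b ≠ c := by
      rintro rfl
      exact ha0 (ZModModule.add_self b)
    exact Finset.mem_coe.1 (hs.isClique (hts hbt) (hts hct) hne).2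

lemma card_le_cayleyCliqueNum_of_graphFinset_subset {V W : Type*} [AddCommGroup V]
    [Module (ZMod 2) V] [Fintype V] [DecidableEq V] [AddCommGroup W] [Module (ZMod 2) W] {n : ℕ}
    {ι : V × W →ₗ[ZMod 2] F2 n} (hι : Function.Injective ι) {M : V →ₗ[ZMod 2] W}
    {A : Finset (F2 n)} (h : graphFinset ι M ⊆ A) : Fintype.card V ≤ cayleyCliqueNum n A := by
  have hinj : Function.Injective fun v : V => ι (v, M v) :=
    fun v v' h => (Prod.mk.inj (hι h)).1
  rw [← Finset.card_univ, ← Finset.card_image_of_injective _ hinj]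
  have hcl : (cayleySumGraph (A : Set (F2 n))).IsClique
      ↑(Finset.univ.image fun v : V => ι (v, M v)) := by
    intro a ha b hb hab
    obtain ⟨v, -, rfl⟩ := Finset.mem_image.1 (Finset.mem_coe.1 ha)
    obtain ⟨v', -, rfl⟩ := Finset.mem_image.1 (Finset.mem_coe.1 hb)
    refine ⟨hab, Finset.mem_coe.2 (h ?_)⟩
    refine Finset.mem_image.2 ⟨v + v', Finset.mem_filter.2 ⟨Finset.mem_univ _, fun h0 => hab ?_⟩, ?_⟩
    · rw [add_eq_zero_iff_eq_neg, ZModModule.neg_eq_self] at h0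
      rw [h0]
    · rw [← map_add ι, Prod.mk_add_mk, map_add]
  exact hcl.card_le_cliqueNum

theorem eventually_randomSubset_lt_cayleyCliqueNum_le (i : ℕ) : ∀ᶠ k : ℕ in atTop, ∀ n : ℕ,
    (2 ^ i + 1) * (n * k) ≤ 2 ^ (i + k + 1) →
    (randomSubset (F2 n)).real {A | 2 ^ k < cayleyCliqueNum n A} ≤ 3 * (1 / 2) ^ k := by
  classical
  filter_upwards [eventually_card_large_clique_le i] with k hk n hn
  rw [randomSubset_real_setOf, div_le_iff₀ (by positivity), mul_comm]
  refine le_trans ?_ (hk n hn)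
  refine Nat.cast_le.2 (Finset.card_le_card fun A hA => ?_)
  rw [Finset.mem_filter] at hA ⊢
  exact ⟨hA.1, exists_finset_card_eq_of_lt_cayleyCliqueNum hA.2⟩

theorem le_randomSubset_le_cayleyCliqueNum {n k : ℕ} (hkn : 3 * k ^ 2 ≤ n)
    (h : 2 ^ k + n ≤ n * k) :
    1 - k * (1 / 2) ^ k ≤ (randomSubset (F2 n)).real {A | 2 ^ k ≤ cayleyCliqueNum n A} := by
  classical
  have hkn' : k ≤ n := le_trans (by nlinarith [Nat.zero_le k]) hkn
  let e : ((Fin k → ZMod 2) × (Fin (n - k) → ZMod 2)) ≃ₗ[ZMod 2] F2 n :=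
    LinearEquiv.ofFinrankEq _ _ (by simp; omega)
  have : Fintype ((Fin k → ZMod 2) →ₗ[ZMod 2] (Fin (n - k) → ZMod 2)) :=
    @Fintype.ofFinite _ (DFunLike.finite _)
  -- The second moment condition with y = k and d = n - k amounts to 3k² + 2^k ≤ nk.
  have hcond : k * (k + k) + 2 ^ k ≤ k * (n - k) := by
    zify [hkn'] at h hkn ⊢
    nlinarith
  have hV : Fintype.card (Fin k → ZMod 2) = 2 ^ k := by simp
  have h1 := le_card_exists_graphFinset_subset (ι := e) e.injective hV
    (by simp : Fintype.card (Fin (n - k) → ZMod 2) = 2 ^ (n - k)) hcond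
  rw [randomSubset_real_setOf, le_div_iff₀ (by positivity)]
  set c := (Finset.univ.filter fun A : Finset (F2 n) =>
    ∃ M : (Fin k → ZMod 2) →ₗ[ZMod 2] (Fin (n - k) → ZMod 2), graphFinset e M ⊆ A).card
  have hc : (c : ℝ) ≤ (Finset.univ.filter fun A : Finset (F2 n) =>
      2 ^ k ≤ cayleyCliqueNum n A).card := by
    refine Nat.cast_le.2 (Finset.card_le_card fun A hA => ?_)
    rw [Finset.mem_filter] at hA ⊢
    obtain ⟨M, hM⟩ := hA.2
    refine ⟨hA.1, ?_⟩
    rw [← hV]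
    exact card_le_cayleyCliqueNum_of_graphFinset_subset (ι := e.toLinearMap) e.injective hM
  refine le_trans ?_ hc
  set x : ℝ := k * (1 / 2) ^ k
  have hx : 0 ≤ x := by positivity
  -- The factor 1 / (1 + x) is at least 1 - x; for x ≥ 1 the bound is trivial.
  rcases le_total x 1 with hx1 | hx1
  · calc (1 - x) * 2 ^ Fintype.card (F2 n) ≤ (1 - x) * ((1 + x) * c) :=
          mul_le_mul_of_nonneg_left h1 (by linarith)
      _ = c - x ^ 2 * c := by ring
      _ ≤ c := by
          have : 0 ≤ x ^ 2 * c := by positivity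
          linarith
  · exact (mul_nonpos_of_nonpos_of_nonneg (by linarith) (by positivity)).trans (Nat.cast_nonneg _)

theorem eventually_le_randomSubset_cayleyCliqueNum_eq (i : ℕ) : ∀ᶠ k : ℕ in atTop, ∀ n : ℕ,
    2 ^ k + n ≤ n * k → (2 ^ i + 1) * (n * k) ≤ 2 ^ (i + k + 1) →
    1 - (k + 3) * (1 / 2) ^ k ≤ (randomSubset (F2 n)).real {A | cayleyCliqueNum n A = 2 ^ k} := by
  filter_upwards [eventually_randomSubset_lt_cayleyCliqueNum_le i,
    eventually_pow_mul_le_two_pow 3 3, eventually_gt_atTop 0] with k hk hk3 hk0 n hn1 hn2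
  have hkn : 3 * k ^ 2 ≤ n := by
    refine Nat.le_of_mul_le_mul_right (c := k) ?_ hk0
    calc 3 * k ^ 2 * k = k ^ 3 * 3 := by ring
      _ ≤ n * k := by omega
  have h1 := hk n hn2
  have h2 := le_randomSubset_le_cayleyCliqueNum hkn hn1
  have h3 : (randomSubset (F2 n)).real {A | 2 ^ k ≤ cayleyCliqueNum n A} ≤
      (randomSubset (F2 n)).real {A | cayleyCliqueNum n A = 2 ^ k} +
      (randomSubset (F2 n)).real {A | 2 ^ k < cayleyCliqueNum n A} := by
    refine le_trans (measureReal_mono fun A hA => ?_) (measureReal_union_le _ _)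
    exact (le_iff_eq_or_lt.1 hA).imp Eq.symm id
  have h4 : ((k : ℝ) + 3) * (1 / 2) ^ k = k * (1 / 2) ^ k + 3 * (1 / 2) ^ k := by ring
  linarith

end Clique

/-! ### The window for n in terms of logarithms. -/

section Asymptotics

lemma tendsto_logb_two_atTop : Tendsto (Real.logb 2) atTop atTop :=
  Real.tendsto_logb_atTop one_lt_two

lemma eventually_logb_two_le_mul {δ : ℝ} (hδ : 0 < δ) : ∀ᶠ x : ℝ in atTop, Real.logb 2 x ≤ δ * x := by
  have h2 : (0 : ℝ) < Real.log 2 := Real.log_pos one_lt_two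
  filter_upwards [Real.isLittleO_log_id_atTop.bound (mul_pos hδ h2), eventually_ge_atTop 1]
    with x hx hx1
  rw [Real.norm_of_nonneg (Real.log_nonneg hx1), id, Real.norm_of_nonneg (by linarith)] at hx
  rw [Real.logb, div_le_iff₀ h2]
  linarith

lemma exists_one_add_sq_le_two_rpow {ε : ℝ} (hε : 0 < ε) :
    ∃ i : ℕ, (1 + (1 / 2 : ℝ) ^ i) ^ 2 ≤ 2 ^ ε := by
  have h1 : Tendsto (fun i : ℕ => (1 + (1 / 2 : ℝ) ^ i) ^ 2) atTop (𝓝 ((1 + 0) ^ 2)) :=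
    ((tendsto_pow_atTop_nhds_zero_of_lt_one (by norm_num) (by norm_num)).const_add 1).pow 2
  have h2 : ((1 + 0 : ℝ)) ^ 2 < 2 ^ ε := by
    rw [add_zero, one_pow]
    exact Real.one_lt_rpow one_lt_two hε
  exact ((h1.eventually_lt_const h2).mono fun _ => le_of_lt).exists

lemma two_rpow_logb_add_logb_logb {x : ℝ} (hx : 1 < x) :
    (2 : ℝ) ^ (Real.logb 2 x + Real.logb 2 (Real.logb 2 x)) = x * Real.logb 2 x := by
  rw [Real.rpow_add two_pos, Real.rpow_logb two_pos (by norm_num) (by linarith),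
    Real.rpow_logb two_pos (by norm_num) (Real.logb_pos one_lt_two hx)]

/-- The upper bound on k gives 2^k ≤ n log n, and log log n ≥ 2 leaves room for log n + 1 ≤ k. -/
lemma two_pow_add_le_mul_of_le_logb {n k : ℕ} (hn : 2 ≤ n)
    (hL : 2 ≤ Real.logb 2 (Real.logb 2 n))
    (h1 : (k : ℝ) ≤ Real.logb 2 n + Real.logb 2 (Real.logb 2 n))
    (h2 : Real.logb 2 n + Real.logb 2 (Real.logb 2 n) < k + 1) : 2 ^ k + n ≤ n * k := by
  have hn1 : (1 : ℝ) < n := by exact_mod_cast hn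
  have h3 : (2 : ℝ) ^ k ≤ n * Real.logb 2 n := by
    rw [← two_rpow_logb_add_logb_logb hn1, ← Real.rpow_natCast]
    exact Real.rpow_le_rpow_of_exponent_le one_le_two h1
  have h4 : (2 : ℝ) ^ k + n ≤ n * k := by
    have : (n : ℝ) * (Real.logb 2 n + 1) ≤ n * k :=
      mul_le_mul_of_nonneg_left (by linarith) (by linarith)
    linarith
  exact_mod_cast h4

/-- Of the two factors 1 + δ that 2^ε must absorb, one replaces k by log n and the other is the
slack claimed in the conclusion. -/
lemma mul_mul_le_two_pow_of_logb_le {ε : ℝ} {i n k : ℕ} (hn : 2 ≤ n)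
    (hi : (1 + (1 / 2 : ℝ) ^ i) ^ 2 ≤ 2 ^ ε)
    (hL : Real.logb 2 (Real.logb 2 n) ≤ (1 / 2) ^ i * Real.logb 2 n)
    (h1 : (k : ℝ) ≤ Real.logb 2 n + Real.logb 2 (Real.logb 2 n))
    (h2 : Real.logb 2 n + Real.logb 2 (Real.logb 2 n) ≤ k + 1 - ε) :
    (2 ^ i + 1) * (n * k) ≤ 2 ^ (i + k + 1) := by
  have hn1 : (1 : ℝ) < n := by exact_mod_cast hn
  set δ : ℝ := (1 / 2) ^ i with hδ
  have hδ0 : 0 < δ := by positivity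
  have hδi : (2 : ℝ) ^ i * δ = 1 := by rw [hδ, ← mul_pow]; norm_num
  have h3 : (n * Real.logb 2 n) * 2 ^ ε ≤ (2 : ℝ) ^ (k + 1) := by
    rw [← two_rpow_logb_add_logb_logb hn1, ← Real.rpow_add two_pos, ← Real.rpow_natCast]
    refine Real.rpow_le_rpow_of_exponent_le one_le_two ?_
    push_cast
    linarith
  have hL0 : 0 < Real.logb 2 n := Real.logb_pos one_lt_two hn1
  have h4 : (n : ℝ) * k ≤ n * Real.logb 2 n * (1 + δ) := by
    rw [mul_assoc]
    exact mul_le_mul_of_nonneg_left (by linarith) (by linarith)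
  have h5 : ((2 : ℝ) ^ i + 1) * (n * k) ≤ 2 ^ (i + k + 1) := by
    calc ((2 : ℝ) ^ i + 1) * (n * k) = 2 ^ i * (1 + δ) * (n * k) := by rw [mul_add, hδi, mul_one]
      _ ≤ 2 ^ i * (1 + δ) * (n * Real.logb 2 n * (1 + δ)) :=
          mul_le_mul_of_nonneg_left h4 (by positivity)
      _ = 2 ^ i * (n * Real.logb 2 n * (1 + δ) ^ 2) := by ring
      _ ≤ 2 ^ i * (n * Real.logb 2 n * 2 ^ ε) := by gcongr
      _ ≤ 2 ^ i * 2 ^ (k + 1) := mul_le_mul_of_nonneg_left h3 (by positivity)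
      _ = 2 ^ (i + k + 1) := by rw [add_assoc, pow_add _ i]
  exact_mod_cast h5

lemma tendsto_one_sub_mul_half_pow :
    Tendsto (fun k : ℕ => 1 - ((k : ℝ) + 3) * (1 / 2) ^ k) atTop (𝓝 1) := by
  have h1 : Tendsto (fun k : ℕ => (k : ℝ) * (1 / 2) ^ k) atTop (𝓝 0) :=
    tendsto_self_mul_const_pow_of_lt_one (by norm_num) (by norm_num)
  have h2 : Tendsto (fun k : ℕ => 3 * (1 / 2 : ℝ) ^ k) atTop (𝓝 (3 * 0)) :=
    (tendsto_pow_atTop_nhds_zero_of_lt_one (by norm_num) (by norm_num)).const_mul 3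
  simpa [add_mul] using (h1.add h2).const_sub 1

end Asymptotics

/-! ### One-point concentration. -/

theorem propositionP (ε : ℝ) (hε : 0 < ε) (n : ℕ → ℕ) (hn_two : ∀ l, 2 ≤ n l)
    (hn_tendsto : Tendsto n atTop atTop)
    (hn_fract : ∀ l, Int.fract (Real.logb 2 (n l) + Real.logb 2 (Real.logb 2 (n l))) < 1 - ε) :
    Tendsto
      (fun l => (randomSubset (F2 (n l))).real
        {A | (cayleyCliqueNum (n l) A : ℝ) =
          (2 : ℝ) ^ ⌊Real.logb 2 (n l) + Real.logb 2 (Real.logb 2 (n l))⌋})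
      atTop (𝓝 1) := by
  set S : ℕ → ℝ := fun l => Real.logb 2 (n l) + Real.logb 2 (Real.logb 2 (n l)) with hS
  have hn_real : Tendsto (fun l => (n l : ℝ)) atTop atTop :=
    tendsto_natCast_atTop_atTop.comp hn_tendsto
  have hlog : Tendsto (fun l => Real.logb 2 (n l)) atTop atTop :=
    tendsto_logb_two_atTop.comp hn_real
  have hloglog : Tendsto (fun l => Real.logb 2 (Real.logb 2 (n l))) atTop atTop :=
    tendsto_logb_two_atTop.comp hlog
  have hS_tendsto : Tendsto S atTop atTop := hlog.atTop_add_atTop hloglog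
  have hk_tendsto : Tendsto (fun l => ⌊S l⌋₊) atTop atTop := tendsto_nat_floor_atTop.comp hS_tendsto
  obtain ⟨i, hi⟩ := exists_one_add_sq_le_two_rpow hε
  refine tendsto_of_tendsto_of_tendsto_of_le_of_le'
    (tendsto_one_sub_mul_half_pow.comp hk_tendsto) tendsto_const_nhds ?_
    (Eventually.of_forall fun l => measureReal_le_one)
  filter_upwards [hk_tendsto.eventually (eventually_le_randomSubset_cayleyCliqueNum_eq i),
    hloglog.eventually_ge_atTop 2, hS_tendsto.eventually_ge_atTop 0,
    hlog.eventually (eventually_logb_two_le_mul (δ := (1 / 2) ^ i) (by positivity))]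
    with l hl hL2 hS0 hLL
  have h1 : (⌊S l⌋₊ : ℝ) ≤ S l := Nat.floor_le hS0
  have h2 : S l < ⌊S l⌋₊ + 1 := Nat.lt_floor_add_one _
  have hfloor : ((⌊S l⌋₊ : ℕ) : ℤ) = ⌊S l⌋ := Int.natCast_floor_eq_floor hS0
  -- The only use of the fractional part hypothesis: it keeps S away from the next integer, where a
  -- clique of twice the size might appear.
  have h3 : S l ≤ ⌊S l⌋₊ + 1 - ε := by
    have h4 := hn_fract l
    have h5 := Int.self_sub_floor (S l)
    have h6 : ((⌊S l⌋ : ℤ) : ℝ) = (⌊S l⌋₊ : ℝ) := by rw [← hfloor, Int.cast_natCast]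
    change Int.fract (S l) < 1 - ε at h4
    linarith
  refine (hl (n l) (two_pow_add_le_mul_of_le_logb (hn_two l) hL2 h1 h2)
    (mul_mul_le_two_pow_of_logb_le (hn_two l) hi hLL h1 h3)).trans (le_of_eq ?_)
  congr 1
  ext A
  simp only [Set.mem_ofPred_eq]
  rw [← hfloor, zpow_natCast]
  exact_mod_cast Iff.rfl
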